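/- Let $n\ge 3$ and $\rho(x)=(1+|x|^2)^{1/2}$. Let $$\mathcal H^1(\mathbb R^n)=\{u\in\mathcal D'(\mathbb R^n):\ \rho^{-1}u\in L_2(\mathbb R^n),\ \nabla u\in L_2(\mathbb R^n)^n\},\qquad \|u\|_{\mathcal H^1(\mathbb R^n)}^2=\|\rho^{-1}u\|_{L_2(\mathbb R^n)}^2+\|\nabla u\|_{L_2(\mathbb R^n)^n}^2,$$ with dual space $\mathcal H^{-1}(\mathbb R^n)$, whose elements act as distributions through the inclusion $\mathcal D(\mathbb R^n)\subset\mathcal H^1(\mathbb R^n)$; all spaces are real, and $\mathcal H^{\pm1}(\mathbb R^n)^n$ carry the Euclidean product norms. Let $\mathbb A=(a_{ij}^{\alpha\beta})_{1\le i,j,\alpha,\beta\le n}$ with real-valued $a_{ij}^{\alpha\beta}\in L_\infty(\mathbb R^n)$ and $\|\mathbb A\|_{L_\infty}=\max_{i,j,\alpha,\beta}\|a_{ij}^{\alpha\beta}\|_{L_\infty(\mathbb R^n)}$, satisfying for almost all $x$ the symmetry conditions $a_{ij}^{\alpha\beta}(x)=a_{\alpha j}^{i\beta}(x)=a_{i\beta}^{\alpha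 j}(x)$ and, for a constant $c_{\mathbb A}>0$, the ellipticity condition $$a_{ij}^{\alpha\beta}(x)\,\xi_{i\alpha}\xi_{j\beta}\ \ge\ c_{\mathbb A}^{-1}\,\xi_{i\alpha}\xi_{i\alpha}\quad\text{for all } \xi\in\mathbb R^{n\times n}\text{ with } \xi=\xi^\top,\ \textstyle\sum_i\xi_{ii}=0$$ (repeated indices are summed). For $u\in\mathcal H^1(\mathbb R^n)^n$ and $\pi\in L_2(\mathbb R^n)$ put $E_{j\beta}(u)=\frac12(\partial_ju_\beta+\partial_\beta u_j)$ and, in the sense of distributions, $$\mathcal L(u,\pi)_i=\partial_\alpha\big(a_{ij}^{\alpha\beta}E_{j\beta}(u)\big)-\partial_i\pi,\qquad i=1,\dots,n.$$ Then for every $f\in\mathcal H^{-1}(\mathbb R^n)^n$ and $g\in L_2(\mathbb R^n)$ the anisotropic Stokes system $$\mathcal L(u,\pi)=f,\qquad \mathrm{div}\,u=g\qquad\text{in }\mathbb R^n$$ has a unique solution $(u,\pi)\in\mathcal H^1(\mathbb R^n)^n\times L_2(\mathbb R^n)$, and $$\|u\|_{\mathcal H^1(\mathbb R^n)^n}+\|\pi\|_{L_2(\mathbb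 R^n)}\le C\big(\|f\|_{\mathcal H^{-1}(\mathbb R^n)^n}+\|g\|_{L_2(\mathbb R^n)}\big),$$ where the constant $C>0$ depends only on $n$, $c_{\mathbb A}$ and an upper bound for $\|\mathbb A\|_{L_\infty}$. Consequently the Newtonian velocity and pressure potentials are well defined: there is a unique pair of continuous linear operators $\mathcal N:\mathcal H^{-1}(\mathbb R^n)^n\to\mathcal H^1(\mathbb R^n)^n$ and $\mathcal Q:\mathcal H^{-1}(\mathbb R^n)^n\to L_2(\mathbb R^n)$ such that, for every $f$, $(u,\pi)=(\mathcal N f,\mathcal Q f)$ solves the system with right-hand side $f$ and $g=0$. -/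

import Mathlib

open MeasureTheory
open scoped ENNReal Distributions LineDeriv

noncomputable section

namespace StokesWeighted

/-- The Euclidean space `ℝⁿ`. -/
abbrev E (n : ℕ) : Type := EuclideanSpace ℝ (Fin n)

/-- The `i`-th standard unit vector. -/
abbrev e {n : ℕ} (i : Fin n) : E n := EuclideanSpace.single i (1 : ℝ)

/-- Test functions `𝓓(ℝⁿ)`. -/
abbrev Test (n : ℕ) : Type := 𝓓((⊤ : TopologicalSpace.Opens (E n)), ℝ)

/-- Distributions `𝓓'(ℝⁿ)`. -/
abbrev Distr (n : ℕ) : Type := 𝓓'((⊤ : TopologicalSpace.Opens (E n)), ℝ)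

/-- The regular distribution `φ ↦ ∫ φ f dx` of a locally integrable function `f`. -/
def distOf {n : ℕ} (f : E n → ℝ) : Distr n :=
  ContinuousLinearMap.toUniformConvergenceCLM (RingHom.id ℝ) ℝ _
    (TestFunction.integralAgainstBilinCLM (ContinuousLinearMap.mul ℝ ℝ) volume f)

theorem distOf_apply {n : ℕ} {f : E n → ℝ} (hf : LocallyIntegrable f volume) (φ : Test n) :
    distOf f φ = ∫ x, φ x * f x :=
  TestFunction.integralAgainstBilinCLM_eq_integral (hf.locallyIntegrableOn _)

/-- The weight `ρ(x) = (1 + |x|²)^{1/2}`. -/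
def rho {n : ℕ} (x : E n) : ℝ := Real.sqrt (1 + ‖x‖ ^ 2)

/-- The measure `ρ⁻² dx`. -/
def weightedVolume (n : ℕ) : Measure (E n) :=
  volume.withDensity fun x => ENNReal.ofReal ((rho x ^ 2)⁻¹)

/-- The space `L₂(ℝⁿ)`. -/
abbrev L2 (n : ℕ) : Type := Lp ℝ 2 (volume : Measure (E n))

/-- The space `L₂(ρ⁻¹; ℝⁿ)` of functions `f` with `ρ⁻¹ f ∈ L₂(ℝⁿ)`, normed by
`‖f‖² = ∫ f² ρ⁻² dx`. -/
abbrev L2w (n : ℕ) : Type := Lp ℝ 2 (weightedVolume n)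

theorem rho_sq {n : ℕ} (x : E n) : rho x ^ 2 = 1 + ‖x‖ ^ 2 :=
  Real.sq_sqrt (by positivity)

theorem rho_sq_pos {n : ℕ} (x : E n) : 0 < rho x ^ 2 := by
  rw [rho_sq]; positivity

theorem continuous_rho {n : ℕ} : Continuous (rho : E n → ℝ) := by
  unfold rho; fun_prop

theorem measurable_weight {n : ℕ} :
    Measurable fun x : E n => ENNReal.ofReal ((rho x ^ 2)⁻¹) :=
  (((continuous_rho (n := n)).measurable.pow_const 2).inv).ennreal_ofReal

theorem volume_ac (n : ℕ) : (volume : Measure (E n)) ≪ weightedVolume n :=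
  withDensity_absolutelyContinuous' measurable_weight.aemeasurable
    (Filter.Eventually.of_forall fun x => by
      rw [ne_eq, ENNReal.ofReal_eq_zero, not_le]
      exact inv_pos.2 (rho_sq_pos x))

theorem weightedVolume_le (n : ℕ) : weightedVolume n ≤ (volume : Measure (E n)) := by
  calc weightedVolume n ≤ volume.withDensity (fun _ => (1 : ℝ≥0∞)) := by
        refine withDensity_mono (Filter.Eventually.of_forall fun x => ?_)
        simp only [ENNReal.ofReal_le_one]
        refine inv_le_one_of_one_le₀ ?_
        rw [rho_sq]
        nlinarith [sq_nonneg ‖x‖]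
    _ = volume := by simp

theorem locallyIntegrable_L2 {n : ℕ} (u : L2 n) : LocallyIntegrable u volume :=
  (Lp.memLp u).locallyIntegrable (by norm_num)

theorem locallyIntegrable_L2w {n : ℕ} (u : L2w n) : LocallyIntegrable u volume := by
  have hm : AEStronglyMeasurable u (volume : Measure (E n)) :=
    (Lp.aestronglyMeasurable u).mono_ac (volume_ac n)
  have h2 : Integrable (fun x => (u x) ^ 2) (weightedVolume n) := (Lp.memLp u).integrable_sq
  have h3 : Integrable (fun x => (rho x ^ 2)⁻¹ * (u x) ^ 2) (volume : Measure (E n)) := by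
    have h2' := (integrable_withDensity_iff_integrable_smul' measurable_weight
      (Filter.Eventually.of_forall fun x => ENNReal.ofReal_lt_top)).1 h2
    refine h2'.congr (Filter.Eventually.of_forall fun x => ?_)
    simp only [smul_eq_mul]
    rw [ENNReal.toReal_ofReal (by positivity)]
  have h4 : LocallyIntegrable (fun x : E n => rho x ^ 2) volume :=
    (continuous_rho.pow 2).locallyIntegrable
  refine (h3.locallyIntegrable.add h4).mono hm (Filter.Eventually.of_forall fun x => ?_)
  have hp := rho_sq_pos x
  have h0 : 0 ≤ (rho x ^ 2)⁻¹ * (u x) ^ 2 := by positivity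
  simp only [Pi.add_apply, Real.norm_eq_abs]
  rw [abs_of_nonneg (by positivity : 0 ≤ (rho x ^ 2)⁻¹ * (u x) ^ 2 + rho x ^ 2)]
  have key : (rho x ^ 2)⁻¹ * (u x) ^ 2 + rho x ^ 2 - 2 * |u x|
      = (rho x ^ 2)⁻¹ * (|u x| - rho x ^ 2) ^ 2 := by
    rw [← sq_abs (u x)]
    generalize rho x ^ 2 = r at hp
    field_simp
    ring
  have : 0 ≤ (rho x ^ 2)⁻¹ * (|u x| - rho x ^ 2) ^ 2 := by positivity
  nlinarith [abs_nonneg (u x)]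

theorem distOf_congr {n : ℕ} {f g : E n → ℝ} (hf : LocallyIntegrable f volume)
    (h : f =ᵐ[volume] g) : distOf f = distOf g := by
  ext φ
  rw [distOf_apply hf, distOf_apply (hf.congr h)]
  exact integral_congr_ae (h.mono fun x hx => by simp [hx])

theorem integrable_test_mul {n : ℕ} {f : E n → ℝ} (hf : LocallyIntegrable f volume)
    (φ : Test n) : Integrable (fun x => φ x * f x) volume :=
  TestFunction.integrable_bilin (ContinuousLinearMap.mul ℝ ℝ) (hf.locallyIntegrableOn _) φ

theorem distOf_add {n : ℕ} {f g : E n → ℝ} (hf : LocallyIntegrable f volume)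
    (hg : LocallyIntegrable g volume) : distOf (f + g) = distOf f + distOf g := by
  ext φ
  rw [distOf_apply (hf.add hg)]
  change _ = distOf f φ + distOf g φ
  rw [distOf_apply hf, distOf_apply hg,
    ← integral_add (integrable_test_mul hf φ) (integrable_test_mul hg φ)]
  simp [mul_add]

theorem distOf_smul {n : ℕ} {f : E n → ℝ} (hf : LocallyIntegrable f volume) (c : ℝ) :
    distOf (c • f) = c • distOf f := by
  ext φ
  rw [distOf_apply (hf.smul c)]
  change _ = c • distOf f φ
  rw [distOf_apply hf, smul_eq_mul, ← integral_const_mul]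
  simp [mul_left_comm]

theorem distOf_zero {n : ℕ} : distOf (0 : E n → ℝ) = 0 := by
  have h := distOf_smul (f := (0 : E n → ℝ)) locallyIntegrable_zero 0
  simpa using h

/-- The ambient Hilbert space `L₂(ρ⁻¹; ℝⁿ) × L₂(ℝⁿ)ⁿ` with
`‖(u, G)‖² = ‖ρ⁻¹ u‖² + ∑ᵢ ‖Gᵢ‖²`. -/
abbrev Ambient (n : ℕ) : Type := WithLp 2 (L2w n × PiLp 2 fun _ : Fin n => L2 n)

/-- The weighted Sobolev space `ℋ¹(ℝⁿ)` of all `u` with `ρ⁻¹ u ∈ L₂(ℝⁿ)` and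
`∇u ∈ L₂(ℝⁿ)ⁿ`, the derivatives being those of distributions. An element is stored as the pair
`(u, ∇u)`, so that the inherited norm is `‖u‖² = ‖ρ⁻¹ u‖² + ‖∇u‖²`. -/
def H1 (n : ℕ) : Submodule ℝ (Ambient n) where
  carrier := {p | ∀ i : Fin n, ∂_{e i} (distOf p.fst) = distOf (p.snd i)}
  add_mem' := by
    intro p q hp hq i
    have h1 : distOf ((p + q).fst : E n → ℝ) = distOf p.fst + distOf q.fst := by
      rw [← distOf_add (locallyIntegrable_L2w _) (locallyIntegrable_L2w _)]
      exact distOf_congr (locallyIntegrable_L2w _)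
        ((volume_ac n).ae_le (Lp.coeFn_add p.fst q.fst))
    have h2 : distOf ((p + q).snd i : E n → ℝ) = distOf (p.snd i) + distOf (q.snd i) := by
      rw [← distOf_add (locallyIntegrable_L2 _) (locallyIntegrable_L2 _)]
      exact distOf_congr (locallyIntegrable_L2 _) (Lp.coeFn_add (p.snd i) (q.snd i))
    rw [h1, h2, LineDeriv.lineDerivOp_add, hp i, hq i]
  zero_mem' := by
    intro i
    have h1 : distOf ((0 : Ambient n).fst : E n → ℝ) = 0 := by
      rw [← distOf_zero]
      exact distOf_congr (locallyIntegrable_L2w _)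
        ((volume_ac n).ae_le (Lp.coeFn_zero ℝ 2 (weightedVolume n)))
    have h2 : distOf ((0 : Ambient n).snd i : E n → ℝ) = 0 := by
      rw [← distOf_zero]
      exact distOf_congr (locallyIntegrable_L2 _) (Lp.coeFn_zero ℝ 2 volume)
    rw [h1, h2]
    ext φ
    simp
  smul_mem' := by
    intro c p hp i
    have h1 : distOf ((c • p).fst : E n → ℝ) = c • distOf p.fst := by
      rw [← distOf_smul (locallyIntegrable_L2w _)]
      exact distOf_congr (locallyIntegrable_L2w _)
        ((volume_ac n).ae_le (Lp.coeFn_smul c p.fst))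
    have h2 : distOf ((c • p).snd i : E n → ℝ) = c • distOf (p.snd i) := by
      rw [← distOf_smul (locallyIntegrable_L2 _)]
      exact distOf_congr (locallyIntegrable_L2 _) (Lp.coeFn_smul c (p.snd i))
    rw [h1, h2, LineDeriv.lineDerivOp_smul, hp i]

/-- The function underlying an element of `ℋ¹(ℝⁿ)`. -/
def fn {n : ℕ} (u : H1 n) : L2w n := (u : Ambient n).fst

/-- The weak partial derivative `∂ᵢ u` of an element of `ℋ¹(ℝⁿ)`. -/
def pd {n : ℕ} (u : H1 n) (i : Fin n) : L2 n := (u : Ambient n).snd i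

theorem memLp_test {n : ℕ} (φ : Test n) : MemLp φ 2 (volume : Measure (E n)) :=
  φ.continuous.memLp_of_hasCompactSupport φ.hasCompactSupport

theorem memLp_test_weighted {n : ℕ} (φ : Test n) : MemLp φ 2 (weightedVolume n) :=
  (memLp_test φ).mono_measure (weightedVolume_le n)

/-- The inclusion of `𝓓(ℝⁿ)` in `ℋ¹(ℝⁿ)`. -/
def testToH1 {n : ℕ} (φ : Test n) : H1 n where
  val := WithLp.toLp 2
    ((memLp_test_weighted φ).toLp φ, WithLp.toLp 2 fun i => (memLp_test (∂_{e i} φ)).toLp _)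
  property := by
    intro i
    ext ψ
    have h1 : (((memLp_test_weighted φ).toLp φ : L2w n) : E n → ℝ) =ᵐ[volume] φ :=
      (volume_ac n).ae_le (MemLp.coeFn_toLp _)
    have h2 : (((memLp_test (∂_{e i} φ)).toLp _ : L2 n) : E n → ℝ) =ᵐ[volume]
      (∂_{e i} φ : Test n) := MemLp.coeFn_toLp _
    have hφ : LocallyIntegrable φ (volume : Measure (E n)) := φ.continuous.locallyIntegrable
    have hdφ : LocallyIntegrable (∂_{e i} φ : Test n) (volume : Measure (E n)) :=
      (∂_{e i} φ : Test n).continuous.locallyIntegrable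
    change (∂_{e i} (distOf (((memLp_test_weighted φ).toLp φ : L2w n) : E n → ℝ))) ψ
      = distOf (((memLp_test (∂_{e i} φ)).toLp _ : L2 n) : E n → ℝ) ψ
    rw [distOf_congr (locallyIntegrable_L2w _) h1, distOf_congr (locallyIntegrable_L2 _) h2,
      Distribution.lineDerivOp_apply_apply, map_neg, distOf_apply hφ, distOf_apply hdφ]
    have hd : ∀ (χ : Test n) (x : E n), (∂_{e i} χ : Test n) x = fderiv ℝ χ x (e i) := by
      intro χ x
      have hdiff : Differentiable ℝ χ := χ.contDiff.differentiable (by simp)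
      rw [TestFunction.lineDerivOp_eq_lineDerivCLM ℝ, TestFunction.lineDerivCLM_apply,
        if_pos (by simp), hdiff.differentiableAt.lineDeriv_eq_fderiv]
    have hi1 := integrable_test_mul hφ (∂_{e i} ψ : Test n)
    have hi2 := integrable_test_mul hdφ ψ
    have hi3 := integrable_test_mul hφ ψ
    simp only [hd] at hi1 hi2 ⊢
    rw [integral_mul_fderiv_eq_neg_fderiv_mul_of_integrable hi1 hi2 hi3
      (fun x _ => (ψ.contDiff.differentiable (by simp)).differentiableAt)
      (fun x _ => (φ.contDiff.differentiable (by simp)).differentiableAt)]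

/-- `ℋ⁻¹(ℝⁿ)`, the dual of `ℋ¹(ℝⁿ)`. -/
abbrev Hm1 (n : ℕ) : Type := StrongDual ℝ (H1 n)

/-- `ℋ¹(ℝⁿ)ⁿ`. -/
abbrev H1Vec (n : ℕ) : Type := PiLp 2 fun _ : Fin n => H1 n

/-- `ℋ⁻¹(ℝⁿ)ⁿ`. -/
abbrev Hm1Vec (n : ℕ) : Type := PiLp 2 fun _ : Fin n => Hm1 n

/-- Coefficients `a_{ij}^{αβ}(x)`, written `a i j α β x`. -/
abbrev Tensor (n : ℕ) : Type := Fin n → Fin n → Fin n → Fin n → E n → ℝ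

/-- `‖𝔸‖ = max ‖a_{ij}^{αβ}‖_{L_∞}`. -/
def tensorNorm {n : ℕ} (a : Tensor n) : ℝ≥0∞ :=
  ⨆ i, ⨆ j, ⨆ α, ⨆ β, eLpNorm (a i j α β) ⊤ volume

/-- Essentially bounded coefficients with the symmetries of a viscosity tensor that are elliptic,
with constant `c`, on symmetric matrices of zero trace. -/
structure IsViscosityTensor {n : ℕ} (a : Tensor n) (c : ℝ) : Prop where
  memLp : ∀ i j α β, MemLp (a i j α β) ⊤ volume
  symm : ∀ᵐ x, ∀ i j α β, a i j α β x = a α j i β x ∧ a i j α β x = a i β α j x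
  elliptic : ∀ᵐ x, ∀ ξ : Matrix (Fin n) (Fin n) ℝ, ξ.IsSymm → ξ.trace = 0 →
    c⁻¹ * ∑ i, ∑ α, ξ i α ^ 2 ≤ ∑ i, ∑ j, ∑ α, ∑ β, a i j α β x * ξ i α * ξ j β

/-- The symmetric gradient `E_{jβ}(u) = (∂_j u_β + ∂_β u_j) / 2`. -/
def symGrad {n : ℕ} (u : H1Vec n) (j β : Fin n) (x : E n) : ℝ :=
  (pd (u β) j x + pd (u j) β x) / 2

/-- The `i`-th component of `ℒ(u, π)`: the distribution
`∂_α (a_{ij}^{αβ} E_{jβ}(u)) - ∂_i π`, summed over `j`, `α`, `β`. -/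
def stokesOp {n : ℕ} (a : Tensor n) (u : H1Vec n) (π : L2 n) (i : Fin n) : Distr n :=
  (∑ α, ∂_{e α} (distOf fun x => ∑ j, ∑ β, a i j α β x * symGrad u j β x)) - ∂_{e i} (distOf π)

/-- The distribution `div u`. -/
def divDistr {n : ℕ} (u : H1Vec n) : Distr n := ∑ i, ∂_{e i} (distOf (fn (u i)))

/-- `(u, π)` solves `ℒ(u, π) = f`, `div u = g` in `𝓓'(ℝⁿ)`; a functional in `ℋ⁻¹(ℝⁿ)` acts as a
distribution through the inclusion of `𝓓(ℝⁿ)` in `ℋ¹(ℝⁿ)`. -/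
def IsStokesSolution {n : ℕ} (a : Tensor n) (u : H1Vec n) (π : L2 n) (f : Hm1Vec n)
    (g : L2 n) : Prop :=
  (∀ (i : Fin n) (φ : Test n), stokesOp a u π i φ = f i (testToH1 φ)) ∧ divDistr u = distOf g

end StokesWeighted

end

open StokesWeighted

/-!
The Stokes system is a saddle-point problem on `ℋ¹(ℝⁿ)ⁿ × L₂(ℝⁿ)`, in which the pressure is the
multiplier of the constraint `div u = g`. It is well posed because the viscous form is coercive on
divergence-free fields and the divergence is onto.

* Test functions are dense in `ℋ¹` (`denseRange_testToH1`): if `w` is orthogonal to all of them, it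
  is orthogonal to the mollifications of `η_m w` for cut-offs `η_m`, hence to `η_m w` itself; and
  `η_m w → w` weakly, because `|∇η_m| ≤ C / ρ`. Density turns the distributional equations into
  identities tested with all of `ℋ¹(ℝⁿ)ⁿ` (`isStokesSolution_iff`), and carries Hardy's inequality
  and the exchange of derivatives below from test functions to `ℋ¹`.
* Hardy's inequality (`hardy`): for `n ≥ 3` the field `x / ρ²` has divergence at least
  `(n - 2) / ρ²`, and so `‖ρ⁻¹ u‖ ≤ 2 ‖∇u‖`. Two integrations by parts (`inner_pd_comm`) give
  Korn's inequality for divergence-free fields, in the form `‖∇u‖² = 2 ‖E(u)‖²` (`korn`). The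
  symmetric gradient of such a field has zero trace, so that the relaxed ellipticity condition
  suffices for coercivity (`viscousForm_coercive`).
* The inf-sup condition (`norm_le_norm_adjoint_divL`): for `q = Δφ` with a test function `φ`, the
  field `∇φ` has divergence `q` and norm at most `√5 ‖q‖`, since `‖∇²φ‖ = ‖Δφ‖`. Such `q` are
  dense in `L₂`, for the mollifications of an `h ∈ L₂` orthogonal to all of them are harmonic
  elements of `ℋ¹`; these have zero energy, and by Hardy's inequality they vanish
  (`eq_zero_of_forall_inner_laplacian`).

The abstract theory of saddle-point problems (`saddle_exists`, `saddle_estimate`) then yields a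
solution and an a priori estimate for every solution. Uniqueness, and the linearity and continuity
of the potentials, follow from that estimate.
-/

noncomputable section

namespace StokesWeighted

open Filter Topology
open scoped ContDiff RealInnerProductSpace Convolution

variable {n : ℕ}

/-! ### Test functions and the Hilbert space `ℋ¹` -/

theorem lineDeriv_test_apply (φ : Test n) (i : Fin n) (x : E n) :
    (∂_{e i} φ : Test n) x = fderiv ℝ φ x (e i) := by
  rw [TestFunction.lineDerivOp_eq_lineDerivCLM ℝ, TestFunction.lineDerivCLM_apply,
    if_pos (by simp),
    (φ.contDiff.differentiable (by simp)).differentiableAt.lineDeriv_eq_fderiv]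

/-- The test function given by a smooth compactly supported function. -/
def mkTest (f : E n → ℝ) (hf : ContDiff ℝ ∞ f) (hc : HasCompactSupport f) : Test n :=
  ⟨f, hf, hc, by simp⟩

@[simp]
theorem mkTest_apply (f : E n → ℝ) (hf : ContDiff ℝ ∞ f) (hc : HasCompactSupport f) (x : E n) :
    mkTest f hf hc x = f x := rfl

/-- Mixed second derivatives of a test function commute. -/
theorem lineDeriv_test_comm (φ : Test n) (i j : Fin n) :
    (∂_{e i} (∂_{e j} φ : Test n) : Test n) = ∂_{e j} (∂_{e i} φ : Test n) := by
  ext x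
  have hd : ∀ (k : Fin n), ⇑(∂_{e k} φ : Test n) = fun y => fderiv ℝ φ y (e k) :=
    fun k => funext (lineDeriv_test_apply φ k)
  have hφ : ContDiff ℝ 2 φ := contDiff_infty.1 φ.contDiff 2
  have h2 : DifferentiableAt ℝ (fderiv ℝ φ) x :=
    ((hφ.fderiv_right (m := 1) (by norm_num)).differentiable (by simp)).differentiableAt
  have hs : IsSymmSndFDerivAt ℝ φ x :=
    (hφ.contDiffAt (x := x)).isSymmSndFDerivAt (by simp)
  rw [lineDeriv_test_apply, lineDeriv_test_apply, hd, hd,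
    fderiv_clm_apply h2 (by fun_prop), fderiv_clm_apply h2 (by fun_prop)]
  simpa using hs.eq (e i) (e j)

/-- Locally integrable functions that define the same distribution agree almost everywhere. -/
theorem ae_eq_of_integral_test {f g : E n → ℝ} (hf : LocallyIntegrable f volume)
    (hg : LocallyIntegrable g volume)
    (h : ∀ φ : Test n, ∫ x, φ x * f x = ∫ x, φ x * g x) : f =ᵐ[volume] g :=
  ae_eq_of_integral_contDiff_smul_eq hf hg fun φ hφ hc => h (mkTest φ hφ hc)

theorem locallyIntegrable_fn (u : H1 n) : LocallyIntegrable (fn u) volume :=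
  locallyIntegrable_L2w _

/-- The definition of the weak derivatives of an element of `ℋ¹`, as an identity of integrals. -/
theorem integral_lineDeriv_mul_fn (u : H1 n) (i : Fin n) (φ : Test n) :
    ∫ x, (∂_{e i} φ : Test n) x * fn u x = -∫ x, φ x * pd u i x := by
  have h := congrArg (fun T : Distr n => T φ) (u.2 i)
  simp only [Distribution.lineDerivOp_apply_apply, map_neg] at h
  rw [distOf_apply (locallyIntegrable_L2w _), distOf_apply (locallyIntegrable_L2 _)] at h
  change -∫ x, (∂_{e i} φ : Test n) x * fn u x = ∫ x, φ x * pd u i x at h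
  linarith

/-- A function with its weak derivatives, as an element of `ℋ¹`. -/
def mkH1 (u : E n → ℝ) (G : Fin n → E n → ℝ) (hu : MemLp u 2 (weightedVolume n))
    (hG : ∀ i, MemLp (G i) 2 volume)
    (h : ∀ (i : Fin n) (φ : Test n),
      ∫ x, (∂_{e i} φ : Test n) x * u x = -∫ x, φ x * G i x) : H1 n where
  val := WithLp.toLp 2 (hu.toLp u, WithLp.toLp 2 fun i => (hG i).toLp _)
  property := by
    intro i
    ext φ
    have h1 : ((hu.toLp u : L2w n) : E n → ℝ) =ᵐ[volume] u :=
      (volume_ac n).ae_le (MemLp.coeFn_toLp _)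
    have h2 : (((hG i).toLp _ : L2 n) : E n → ℝ) =ᵐ[volume] G i := MemLp.coeFn_toLp _
    change (∂_{e i} (distOf ((hu.toLp u : L2w n) : E n → ℝ))) φ
      = distOf (((hG i).toLp _ : L2 n) : E n → ℝ) φ
    rw [Distribution.lineDerivOp_apply_apply, map_neg, distOf_apply (locallyIntegrable_L2w _),
      distOf_apply (locallyIntegrable_L2 _),
      integral_congr_ae (h1.mono fun x hx => congrArg ((∂_{e i} φ : Test n) x * ·) hx),
      integral_congr_ae (h2.mono fun x hx => congrArg (φ x * ·) hx), h i φ, neg_neg]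

theorem fn_mkH1 {u : E n → ℝ} {G : Fin n → E n → ℝ} (hu : MemLp u 2 (weightedVolume n))
    (hG : ∀ i, MemLp (G i) 2 volume) (h) : fn (mkH1 u G hu hG h) =ᵐ[volume] u :=
  (volume_ac n).ae_le (MemLp.coeFn_toLp hu)

theorem coe_pd_mkH1 {u : E n → ℝ} {G : Fin n → E n → ℝ} (hu : MemLp u 2 (weightedVolume n))
    (hG : ∀ i, MemLp (G i) 2 volume) (h) (i : Fin n) :
    pd (mkH1 u G hu hG h) i =ᵐ[volume] G i :=
  (hG i).coeFn_toLp

theorem pd_testToH1 (φ : Test n) (i : Fin n) :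
    pd (testToH1 φ) i = (memLp_test (∂_{e i} φ)).toLp _ := rfl

theorem coe_pd_testToH1 (φ : Test n) (i : Fin n) :
    pd (testToH1 φ) i =ᵐ[volume] (∂_{e i} φ : Test n) :=
  MemLp.coeFn_toLp (memLp_test (∂_{e i} φ))

/-- The function underlying an element of `ℋ¹`, as a continuous linear map. -/
def fnL (n : ℕ) : H1 n →L[ℝ] L2w n :=
  (WithLp.fstL 2 ℝ _ _).comp (H1 n).subtypeL

/-- The `i`-th weak derivative as a continuous linear map. -/
def pdL (i : Fin n) : H1 n →L[ℝ] L2 n :=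
  (PiLp.proj 2 (fun _ : Fin n => L2 n) i).comp
    ((WithLp.sndL 2 ℝ _ _).comp (H1 n).subtypeL)

@[simp] theorem pdL_apply (i : Fin n) (u : H1 n) : pdL i u = pd u i := rfl

theorem H1_inner (u v : H1 n) : ⟪u, v⟫ = ⟪fn u, fn v⟫ + ∑ i, ⟪pd u i, pd v i⟫ := by
  rw [Submodule.coe_inner, WithLp.prod_inner_apply, PiLp.inner_apply]
  rfl

theorem H1_norm_sq (u : H1 n) : ‖u‖ ^ 2 = ‖fn u‖ ^ 2 + ∑ i, ‖pd u i‖ ^ 2 := by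
  simp only [← real_inner_self_eq_norm_sq, H1_inner]

theorem H1Vec_norm_sq (u : H1Vec n) :
    ‖u‖ ^ 2 = ∑ j, (‖fn (u j)‖ ^ 2 + ∑ i, ‖pd (u j) i‖ ^ 2) := by
  rw [PiLp.norm_sq_eq_of_L2]
  exact Finset.sum_congr rfl fun j _ => H1_norm_sq _

theorem L2_inner_eq_integral (f g : L2 n) : ⟪f, g⟫ = ∫ x, f x * g x := by
  rw [L2.inner_def]
  simp [mul_comm]

/-- A weighted integral in terms of Lebesgue measure. -/
theorem integral_weightedVolume (f : E n → ℝ) :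
    ∫ x, f x ∂(weightedVolume n) = ∫ x, (rho x ^ 2)⁻¹ * f x := by
  rw [weightedVolume, integral_withDensity_eq_integral_toReal_smul measurable_weight
    (Eventually.of_forall fun x => ENNReal.ofReal_lt_top)]
  refine integral_congr_ae (Eventually.of_forall fun x => ?_)
  have := rho_sq_pos x
  simp only [smul_eq_mul]
  rw [ENNReal.toReal_ofReal (by positivity)]

theorem integrable_weightedVolume_iff {f : E n → ℝ} :
    Integrable f (weightedVolume n) ↔ Integrable (fun x => (rho x ^ 2)⁻¹ * f x) volume := by
  rw [weightedVolume, integrable_withDensity_iff_integrable_smul' measurable_weight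
      (Eventually.of_forall fun x => ENNReal.ofReal_lt_top)]
  refine integrable_congr (Eventually.of_forall fun x => ?_)
  have := rho_sq_pos x
  simp only [smul_eq_mul]
  rw [ENNReal.toReal_ofReal (by positivity)]

theorem L2w_inner_eq_integral (f g : L2w n) : ⟪f, g⟫ = ∫ x, (rho x ^ 2)⁻¹ * (f x * g x) := by
  rw [L2.inner_def, integral_weightedVolume]
  simp [mul_comm]

theorem integral_test_mul_L2 (φ : Test n) (f : L2 n) :
    ∫ x, φ x * f x = ⟪(memLp_test φ).toLp φ, f⟫ := by
  rw [L2_inner_eq_integral]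
  refine integral_congr_ae ((memLp_test φ).coeFn_toLp.mono fun x hx => ?_)
  simp only [hx]

theorem contDiff_rho_sq {m : ℕ∞ω} : ContDiff ℝ m fun x : E n => rho x ^ 2 := by
  simp only [rho_sq]
  exact contDiff_const.add (contDiff_norm_sq ℝ)

/-- The test function `ρ² φ`. -/
def rhoSqMul (φ : Test n) : Test n :=
  mkTest (fun x => rho x ^ 2 * φ x) (contDiff_rho_sq.mul φ.contDiff)
    φ.hasCompactSupport.mul_left

theorem integral_test_mul_L2w (φ : Test n) (f : L2w n) :
    ∫ x, φ x * f x = ⟪(memLp_test_weighted (rhoSqMul φ)).toLp _, f⟫ := by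
  rw [L2w_inner_eq_integral]
  have h : ((memLp_test_weighted (rhoSqMul φ)).toLp _ : L2w n) =ᵐ[volume] rhoSqMul φ :=
    (volume_ac n).ae_le (MemLp.coeFn_toLp _)
  refine integral_congr_ae (h.mono fun x hx => ?_)
  have : rho x ≠ 0 := fun h => (rho_sq_pos x).ne' (by simp [h])
  simp only [hx]
  simp only [rhoSqMul, mkTest_apply]
  field_simp

/-- `ℋ¹` is closed in the ambient Hilbert space: weak derivatives are defined by identities between
continuous functionals. -/
theorem isClosed_H1 (n : ℕ) : IsClosed (H1 n : Set (Ambient n)) := by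
  have hset : (H1 n : Set (Ambient n)) = ⋂ (i : Fin n) (φ : Test n),
      {p : Ambient n | -⟪(memLp_test_weighted (rhoSqMul (∂_{e i} φ : Test n))).toLp _, p.fst⟫
        = ⟪(memLp_test φ).toLp φ, p.snd i⟫} := by
    ext p
    simp only [Set.mem_iInter, Set.mem_ofPred_eq]
    refine forall_congr' fun i => ?_
    rw [DFunLike.ext_iff]
    refine forall_congr' fun φ => ?_
    rw [← integral_test_mul_L2, ← integral_test_mul_L2w, Distribution.lineDerivOp_apply_apply,
      map_neg, distOf_apply (locallyIntegrable_L2w _), distOf_apply (locallyIntegrable_L2 _)]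
  rw [hset]
  refine isClosed_iInter fun i => isClosed_iInter fun φ => isClosed_eq ?_ ?_
  · exact ((continuous_const.inner (WithLp.fstL 2 ℝ _ _).continuous)).neg
  · exact continuous_const.inner ((PiLp.proj (𝕜 := ℝ) 2 (fun _ : Fin n => L2 n) i).continuous.comp
      (WithLp.sndL 2 ℝ _ _).continuous)

instance : CompleteSpace (H1 n) := (isClosed_H1 n).completeSpace_coe

/-! ### Mollification in `L₂` -/

/-- **Minkowski's integral inequality** in `L₂`, for a superposition `∫ k(t) F(·, t) dt` of
functions whose norms are at most `δ`. -/
theorem eLpNorm_integral_mul_le {k : E n → ℝ} {F : E n → E n → ℝ} (hk : Continuous k)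
    (hF : AEStronglyMeasurable (Function.uncurry F) (volume.prod volume)) {δ : ℝ≥0∞}
    (hδ : ∀ t, k t ≠ 0 → eLpNorm (fun x => F x t) 2 volume ≤ δ) :
    eLpNorm (fun x => ∫ t, k t * F x t) 2 volume ≤ (∫⁻ t, ‖k t‖ₑ) * δ := by
  have hsq : ∀ f : E n → ℝ, eLpNorm f 2 volume ^ (2 : ℝ) = ∫⁻ x, ‖f x‖ₑ ^ (2 : ℝ) := by
    intro f
    have := eLpNorm_nnreal_pow_eq_lintegral (f := f) (μ := volume) (p := 2) (by norm_num)
    simpa using this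
  have hkm : AEMeasurable (fun t => ‖k t‖ₑ) volume := hk.enorm.measurable.aemeasurable
  have hslice : ∀ᵐ x, AEStronglyMeasurable (F x) volume := hF.prodMk_left
  -- Cauchy–Schwarz with respect to the measure `|k(t)| dt`
  have hpt : ∀ᵐ x, ‖∫ t, k t * F x t‖ₑ ^ (2 : ℝ) ≤
      (∫⁻ t, ‖k t‖ₑ) * ∫⁻ t, ‖k t‖ₑ * ‖F x t‖ₑ ^ (2 : ℝ) := by
    filter_upwards [hslice] with x hx
    have h1 : ‖∫ t, k t * F x t‖ₑ ≤
        ∫⁻ t, (‖k t‖ₑ ^ (1 / 2 : ℝ)) * (‖k t‖ₑ ^ (1 / 2 : ℝ) * ‖F x t‖ₑ) := by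
      refine (enorm_integral_le_lintegral_enorm _).trans (le_of_eq ?_)
      refine lintegral_congr fun t => ?_
      rw [← mul_assoc, ← ENNReal.rpow_add_of_nonneg _ _ (by norm_num) (by norm_num), enorm_mul]
      norm_num
    have h2 := ENNReal.lintegral_mul_le_Lp_mul_Lq volume Real.HolderConjugate.two_two
      (hkm.pow_const (1 / 2 : ℝ)) ((hkm.pow_const (1 / 2 : ℝ)).mul hx.enorm)
    have h3 := ENNReal.rpow_le_rpow (h1.trans h2) (by norm_num : (0 : ℝ) ≤ 2)
    refine h3.trans (le_of_eq ?_)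
    rw [ENNReal.mul_rpow_of_nonneg _ _ (by norm_num), ← ENNReal.rpow_mul, ← ENNReal.rpow_mul]
    norm_num only [ENNReal.rpow_one]
    congr 1
    · refine lintegral_congr fun t => ?_
      rw [← ENNReal.rpow_mul]; norm_num
    · refine lintegral_congr fun t => ?_
      simp only [Pi.mul_apply]
      rw [ENNReal.mul_rpow_of_nonneg _ _ (by norm_num), ← ENNReal.rpow_mul]
      norm_num
  have hmeas : AEMeasurable (Function.uncurry fun x t => ‖k t‖ₑ * ‖F x t‖ₑ ^ (2 : ℝ))
      (volume.prod volume) :=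
    ((hk.enorm.measurable.comp measurable_snd).aemeasurable).mul (hF.enorm.pow_const _)
  have hmain : eLpNorm (fun x => ∫ t, k t * F x t) 2 volume ^ (2 : ℝ) ≤
      ((∫⁻ t, ‖k t‖ₑ) * δ) ^ (2 : ℝ) := by
    rw [hsq]
    calc ∫⁻ x, ‖∫ t, k t * F x t‖ₑ ^ (2 : ℝ)
        ≤ ∫⁻ x, (∫⁻ t, ‖k t‖ₑ) * ∫⁻ t, ‖k t‖ₑ * ‖F x t‖ₑ ^ (2 : ℝ) := lintegral_mono_ae hpt
      _ = (∫⁻ t, ‖k t‖ₑ) * ∫⁻ x, ∫⁻ t, ‖k t‖ₑ * ‖F x t‖ₑ ^ (2 : ℝ) :=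
          lintegral_const_mul'' _ hmeas.lintegral_prod_right'
      _ = (∫⁻ t, ‖k t‖ₑ) * ∫⁻ t, ∫⁻ x, ‖k t‖ₑ * ‖F x t‖ₑ ^ (2 : ℝ) := by
          rw [lintegral_lintegral_swap hmeas]
      _ ≤ (∫⁻ t, ‖k t‖ₑ) * ∫⁻ t, ‖k t‖ₑ * δ ^ (2 : ℝ) := by
          gcongr with t
          rw [lintegral_const_mul' _ _ enorm_ne_top, ← hsq]
          by_cases ht : k t = 0
          · simp [ht]
          · gcongr
            exact hδ t ht
      _ = ((∫⁻ t, ‖k t‖ₑ) * δ) ^ (2 : ℝ) := by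
          rw [lintegral_mul_const'' _ hkm, ENNReal.mul_rpow_of_nonneg _ _ (by norm_num),
            ← mul_assoc]
          simp [sq]
  exact (ENNReal.rpow_le_rpow_iff (by norm_num : (0 : ℝ) < 2)).1 hmain

theorem aestronglyMeasurable_sub_uncurry {h : E n → ℝ} (hh : AEStronglyMeasurable h volume) :
    AEStronglyMeasurable (Function.uncurry fun x t : E n => h (x - t)) (volume.prod volume) :=
  hh.comp_quasiMeasurePreserving (quasiMeasurePreserving_sub volume volume)

theorem eLpNorm_comp_sub_right {h : E n → ℝ} (hh : AEStronglyMeasurable h volume) (t : E n) :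
    eLpNorm (fun x => h (x - t)) 2 volume = eLpNorm h 2 volume :=
  eLpNorm_comp_measurePreserving hh (measurePreserving_sub_right volume t)

/-- The convolution `(h ⋆ k)(x) = ∫ h(t) k(x - t) dt` of real functions. -/
def conv (h k : E n → ℝ) : E n → ℝ := h ⋆[ContinuousLinearMap.mul ℝ ℝ, volume] k

theorem conv_apply (h k : E n → ℝ) (x : E n) : conv h k x = ∫ t, h t * k (x - t) := rfl

theorem conv_apply_swap (h k : E n → ℝ) (x : E n) : conv h k x = ∫ t, k t * h (x - t) := by
  rw [conv, convolution_mul_swap]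
  simp [mul_comm]

theorem conv_congr {h h' : E n → ℝ} (hh : h =ᵐ[volume] h') (k : E n → ℝ) :
    conv h k = conv h' k :=
  convolution_congr _ hh EventuallyEq.rfl

theorem contDiff_conv {h : E n → ℝ} (hh : LocallyIntegrable h volume) (k : Test n) :
    ContDiff ℝ ∞ (conv h k) :=
  k.hasCompactSupport.contDiff_convolution_right _ hh k.contDiff

theorem fderiv_conv {h : E n → ℝ} (hh : LocallyIntegrable h volume) (k : Test n) (x : E n)
    (i : Fin n) : fderiv ℝ (conv h k) x (e i) = conv h (∂_{e i} k : Test n) x := by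
  have hk1 : ContDiff ℝ 1 k := contDiff_infty.1 k.contDiff 1
  have hc := k.hasCompactSupport
  rw [conv, (hc.hasFDerivAt_convolution_right (ContinuousLinearMap.mul ℝ ℝ) hh hk1 x).fderiv,
    convolution_precompR_apply _ hh (hc.fderiv ℝ) (hk1.continuous_fderiv (by norm_num))]
  simp only [conv, convolution_def, lineDeriv_test_apply]

/-- **Young's inequality** for `L₂ ⋆ L₁`, for kernels that are test functions. -/
theorem memLp_conv {h : E n → ℝ} (hh : MemLp h 2 volume) (k : Test n) :
    MemLp (conv h k) 2 volume := by
  refine ⟨(contDiff_conv (hh.locallyIntegrable (by norm_num))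
    k).continuous.aestronglyMeasurable, ?_⟩
  have h1 : conv h k = fun x => ∫ t, k t * h (x - t) := funext (conv_apply_swap h k)
  rw [h1]
  refine (eLpNorm_integral_mul_le k.continuous (aestronglyMeasurable_sub_uncurry hh.1)
    (δ := eLpNorm h 2 volume) fun t _ => (eLpNorm_comp_sub_right hh.1 t).le).trans_lt ?_
  exact ENNReal.mul_lt_top (k.continuous.integrable_of_hasCompactSupport k.hasCompactSupport).2
    hh.2

/-- Translations act continuously on `L₂`. -/
theorem exists_eLpNorm_sub_translate_le {h : E n → ℝ} (hh : MemLp h 2 volume) {ε : ℝ}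
    (hε : 0 < ε) :
    ∃ δ > 0, ∀ t : E n, ‖t‖ < δ →
      eLpNorm (fun x => h (x - t) - h x) 2 volume ≤ ENNReal.ofReal ε := by
  let F : C(E n, C(E n, E n)) :=
    ContinuousMap.curry ⟨fun p : E n × E n => p.2 - p.1, by fun_prop⟩
  have hmp : ∀ t, MeasurePreserving (F t) (volume : Measure (E n)) volume :=
    fun t => measurePreserving_sub_right volume t
  have hcont : Continuous fun t => Lp.compMeasurePreserving (F t) (hmp t) (hh.toLp h) :=
    continuous_const.compMeasurePreservingLp F.continuous hmp (by norm_num)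
  obtain ⟨δ, hδ, H⟩ := Metric.continuous_iff.1 hcont 0 ε hε
  refine ⟨δ, hδ, fun t ht => ?_⟩
  have h1 := H t (by simpa using ht)
  have h0 : Lp.compMeasurePreserving (F 0) (hmp 0) (hh.toLp h) = hh.toLp h := by
    rw [Lp.toLp_compMeasurePreserving]
    congr 1
    ext x
    simp [F]
  rw [h0, Lp.toLp_compMeasurePreserving, Lp.dist_def] at h1
  have h2 : (fun x => h (x - t) - h x) =ᵐ[volume]
      (((hh.comp_measurePreserving (hmp t)).toLp (h ∘ F t) : L2 n) : E n → ℝ) -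
        ((hh.toLp h : L2 n) : E n → ℝ) := by
    filter_upwards [(hh.comp_measurePreserving (hmp t)).coeFn_toLp, hh.coeFn_toLp] with x hx hx'
    simp only [Pi.sub_apply, hx, hx']
    rfl
  rw [eLpNorm_congr_ae h2]
  refine (ENNReal.le_ofReal_iff_toReal_le ?_ hε.le).2 h1.le
  exact (((Lp.memLp _).sub (Lp.memLp _)).2).ne

/-- The bump function from which `mollifier n m` is made. -/
def mollifierBump (n m : ℕ) : ContDiffBump (0 : E n) :=
  ⟨1 / (2 * (m + 1)), 1 / (m + 1), by positivity, by
    apply one_div_lt_one_div_of_lt <;> linarith [(Nat.cast_nonneg m : (0 : ℝ) ≤ m)]⟩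

/-- A standard sequence of mollifiers: smooth, non-negative, of integral one, and supported in the
ball of radius `1 / (m + 1)`. -/
def mollifier (n m : ℕ) : Test n :=
  mkTest ((mollifierBump n m).normed volume) (ContDiffBump.contDiff_normed _)
    (ContDiffBump.hasCompactSupport_normed _)

theorem integral_mollifier (n m : ℕ) : ∫ x, mollifier n m x = 1 :=
  ContDiffBump.integral_normed _

theorem lintegral_mollifier (n m : ℕ) : ∫⁻ x, ‖mollifier n m x‖ₑ = 1 := by
  have hnn : ∀ x, 0 ≤ mollifier n m x := fun x => ContDiffBump.nonneg_normed _ x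
  have hi : Integrable (mollifier n m) volume :=
    (mollifier n m).continuous.integrable_of_hasCompactSupport (mollifier n m).hasCompactSupport
  have h := ofReal_integral_eq_lintegral_ofReal hi (Eventually.of_forall hnn)
  rw [integral_mollifier, ENNReal.ofReal_one] at h
  rw [h]
  exact lintegral_congr fun x => Real.enorm_of_nonneg (hnn x)

theorem norm_lt_of_mollifier_ne_zero {m : ℕ} {x : E n} (h : mollifier n m x ≠ 0) :
    ‖x‖ < 1 / (m + 1) := by
  have hx : x ∈ Function.support ((mollifierBump n m).normed volume) := h
  rw [ContDiffBump.support_normed_eq] at hx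
  exact mem_ball_zero_iff.1 hx

/-- Mollifications converge in `L₂`. -/
theorem tendsto_eLpNorm_conv_mollifier {h : E n → ℝ} (hh : MemLp h 2 volume) :
    Tendsto (fun m => eLpNorm (fun x => conv h (mollifier n m) x - h x) 2 volume) atTop
      (𝓝 0) := by
  rw [ENNReal.tendsto_nhds_zero]
  intro ε hε
  obtain ⟨r, hr, hrε⟩ : ∃ r : ℝ, 0 < r ∧ ENNReal.ofReal r ≤ ε := by
    rcases eq_or_ne ε ⊤ with rfl | htop
    · exact ⟨1, one_pos, le_top⟩
    · exact ⟨ε.toReal, ENNReal.toReal_pos hε.ne' htop, (ENNReal.ofReal_toReal htop).le⟩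
  obtain ⟨δ, hδ, H⟩ := exists_eLpNorm_sub_translate_le hh hr
  filter_upwards [(tendsto_one_div_add_atTop_nhds_zero_nat (𝕜 := ℝ)).eventually_lt_const hδ]
    with m hm
  have hk := (mollifier n m).continuous
  have hc := (mollifier n m).hasCompactSupport
  have hint : ∀ x, Integrable (fun t => mollifier n m t * h (x - t)) volume := by
    intro x
    exact (hc.convolutionExists_left (ContinuousLinearMap.mul ℝ ℝ) hk
      (hh.locallyIntegrable (by norm_num))) x
  have h1 : (fun x => conv h (mollifier n m) x - h x) =
      fun x => ∫ t, mollifier n m t * (h (x - t) - h x) := by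
    ext x
    simp only [mul_sub]
    rw [integral_sub (hint x)
      ((hk.integrable_of_hasCompactSupport hc).mul_const _), integral_mul_const,
      integral_mollifier, one_mul, conv_apply_swap]
  rw [h1]
  refine (eLpNorm_integral_mul_le hk
    (F := fun x t => h (x - t) - h x)
    ((aestronglyMeasurable_sub_uncurry hh.1).sub (hh.1.comp_fst)) (δ := ENNReal.ofReal r)
      fun t ht => H t ((norm_lt_of_mollifier_ne_zero ht).trans hm)).trans ?_
  rw [lintegral_mollifier, one_mul]
  exact hrε

/-- Reflection and translation `t ↦ k(x - t)` of a test function. -/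
def reflectTest (k : Test n) (x : E n) : Test n :=
  mkTest (fun t => k (x - t)) (k.contDiff.comp (contDiff_const.sub contDiff_id))
    (k.hasCompactSupport.comp_homeomorph (Homeomorph.subLeft x))

@[simp]
theorem reflectTest_apply (k : Test n) (x t : E n) : reflectTest k x t = k (x - t) := rfl

theorem lineDeriv_reflectTest (k : Test n) (x : E n) (i : Fin n) :
    (∂_{e i} (reflectTest k x) : Test n) = -reflectTest (∂_{e i} k) x := by
  ext t
  rw [lineDeriv_test_apply]
  have h1 : HasFDerivAt (fun t : E n => x - t) (-ContinuousLinearMap.id ℝ (E n)) t := by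
    simpa using (hasFDerivAt_id t).const_sub x
  have h2 : HasFDerivAt k (fderiv ℝ k (x - t)) (x - t) :=
    (k.contDiff.differentiable (by simp) _).hasFDerivAt
  have h3 : HasFDerivAt (reflectTest k x) _ t := h2.comp t h1
  rw [h3.fderiv]
  change _ = -((∂_{e i} k : Test n) (x - t))
  rw [lineDeriv_test_apply]
  simp

/-- Mollification commutes with weak derivatives. -/
theorem fderiv_conv_fn (u : H1 n) (k : Test n) (x : E n) (i : Fin n) :
    fderiv ℝ (conv (fn u) k) x (e i) = conv (pd u i) k x := by
  rw [fderiv_conv (locallyIntegrable_fn u) k]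
  have h := integral_lineDeriv_mul_fn u i (reflectTest k x)
  rw [lineDeriv_reflectTest] at h
  change ∫ t, -(∂_{e i} k : Test n) (x - t) * fn u t = _ at h
  simp only [neg_mul, integral_neg, neg_inj, reflectTest_apply] at h
  simp only [conv_apply]
  rw [← integral_congr_ae (Eventually.of_forall fun t => mul_comm _ _), h]
  exact integral_congr_ae (Eventually.of_forall fun t => mul_comm _ _)

/-! ### Density of the test functions in `ℋ¹` -/

theorem rho_pos (x : E n) : 0 < rho x :=
  Real.sqrt_pos.2 (by positivity)

theorem memLp_rho_inv_mul {u : E n → ℝ} (hu : MemLp u 2 (weightedVolume n)) :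
    MemLp (fun x => (rho x)⁻¹ * u x) 2 volume := by
  have hm : AEStronglyMeasurable (fun x => (rho x)⁻¹ * u x) (volume : Measure (E n)) :=
    (continuous_rho.inv₀ fun x => (rho_pos x).ne').aestronglyMeasurable.mul
      (hu.1.mono_ac (volume_ac n))
  rw [memLp_two_iff_integrable_sq hm]
  have := integrable_weightedVolume_iff.1 hu.integrable_sq
  simpa [mul_pow] using this

theorem memLp_rho_inv_mul_fn (u : H1 n) : MemLp (fun x => (rho x)⁻¹ * fn u x) 2 volume :=
  memLp_rho_inv_mul (Lp.memLp (fn u))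

/-- Multiplication by a function dominated by `ρ⁻¹` maps `L₂(ρ⁻¹)` to `L₂`. -/
theorem memLp_mul_of_le_rho_inv {η u : E n → ℝ} (hη : Continuous η) {C : ℝ}
    (hC : ∀ x, |η x| ≤ C * (rho x)⁻¹) (hu : MemLp u 2 (weightedVolume n)) :
    MemLp (fun x => η x * u x) 2 volume := by
  refine (memLp_rho_inv_mul hu).of_le_mul (c := C)
    (hη.aestronglyMeasurable.mul (hu.1.mono_ac (volume_ac n)))
    (Eventually.of_forall fun x => ?_)
  have := rho_pos x
  rw [norm_mul, norm_mul, ← mul_assoc, norm_inv, Real.norm_eq_abs (η x),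
    Real.norm_eq_abs (rho x), abs_of_pos this]
  exact mul_le_mul_of_nonneg_right (hC x) (norm_nonneg _)

theorem exists_abs_test_le (η : Test n) : ∃ C, ∀ x, |η x| ≤ C := by
  obtain ⟨C, hC⟩ := η.hasCompactSupport.exists_bound_of_continuous η.continuous
  exact ⟨C, hC⟩

theorem exists_abs_test_le_rho_inv (η : Test n) : ∃ C, ∀ x, |η x| ≤ C * (rho x)⁻¹ := by
  obtain ⟨C, hC⟩ := (η.hasCompactSupport.mul_left (f := rho)).exists_bound_of_continuous
    (continuous_rho.mul η.continuous)
  refine ⟨C, fun x => ?_⟩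
  have h := hC x
  have hr := rho_pos x
  simp only [Pi.mul_apply, norm_mul, Real.norm_eq_abs, abs_of_pos hr] at h
  rw [← div_eq_mul_inv, le_div_iff₀ hr]
  linarith

theorem memLp_test_mul_L2w (η : Test n) {u : E n → ℝ} (hu : MemLp u 2 (weightedVolume n)) :
    MemLp (fun x => η x * u x) 2 volume := by
  obtain ⟨C, hC⟩ := exists_abs_test_le_rho_inv η
  exact memLp_mul_of_le_rho_inv η.continuous hC hu

theorem memLp_test_mul_L2 (η : Test n) (f : L2 n) : MemLp (fun x => η x * f x) 2 volume := by
  obtain ⟨C, hC⟩ := exists_abs_test_le η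
  refine (Lp.memLp f).of_le_mul (c := C)
    (η.continuous.aestronglyMeasurable.mul (Lp.aestronglyMeasurable f))
    (Eventually.of_forall fun x => ?_)
  rw [norm_mul]
  exact mul_le_mul_of_nonneg_right (hC x) (norm_nonneg _)

/-- The product of two test functions. -/
def mulTest (η φ : Test n) : Test n :=
  mkTest (fun x => η x * φ x) (η.contDiff.mul φ.contDiff) φ.hasCompactSupport.mul_left

@[simp]
theorem mulTest_apply (η φ : Test n) (x : E n) : mulTest η φ x = η x * φ x := rfl

theorem lineDeriv_mulTest (η φ : Test n) (i : Fin n) (x : E n) :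
    (∂_{e i} (mulTest η φ) : Test n) x =
      η x * (∂_{e i} φ : Test n) x + (∂_{e i} η : Test n) x * φ x := by
  simp only [lineDeriv_test_apply]
  have h1 := (η.contDiff.differentiable (by simp)) x
  have h2 := (φ.contDiff.differentiable (by simp)) x
  have h3 : HasFDerivAt (mulTest η φ) _ x := h1.hasFDerivAt.mul h2.hasFDerivAt
  rw [h3.fderiv]
  simp
  ring

/-- The product `η u` of a test function and an element of `ℋ¹`. -/
def mulH1 (η : Test n) (u : H1 n) : H1 n :=
  mkH1 (fun x => η x * fn u x)
    (fun i x => η x * pd u i x + (∂_{e i} η : Test n) x * fn u x)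
    ((memLp_test_mul_L2w η (Lp.memLp (fn u))).mono_measure (weightedVolume_le n))
    (fun i => (memLp_test_mul_L2 η (pd u i)).add
      (memLp_test_mul_L2w (∂_{e i} η) (Lp.memLp (fn u))))
    (by
      intro i φ
      have h := integral_lineDeriv_mul_fn u i (mulTest η φ)
      have i1 : Integrable (fun x => (∂_{e i} φ : Test n) x * (η x * fn u x)) volume := by
        refine (integrable_test_mul (locallyIntegrable_fn u)
          (mulTest η (∂_{e i} φ))).congr (Eventually.of_forall fun x => ?_)
        simp only [mulTest_apply]; ring
      have i2 : Integrable (fun x => φ x * ((∂_{e i} η : Test n) x * fn u x)) volume := by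
        refine (integrable_test_mul (locallyIntegrable_fn u)
          (mulTest φ (∂_{e i} η))).congr (Eventually.of_forall fun x => ?_)
        simp only [mulTest_apply]; ring
      have i3 : Integrable (fun x => φ x * (η x * pd u i x)) volume := by
        refine (integrable_test_mul (locallyIntegrable_L2 (pd u i))
          (mulTest φ η)).congr (Eventually.of_forall fun x => ?_)
        simp only [mulTest_apply]; ring
      have e1 : ∫ x, (∂_{e i} (mulTest η φ) : Test n) x * fn u x =
          (∫ x, (∂_{e i} φ : Test n) x * (η x * fn u x)) +
            ∫ x, φ x * ((∂_{e i} η : Test n) x * fn u x) := by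
        rw [← integral_add i1 i2]
        refine integral_congr_ae (Eventually.of_forall fun x => ?_)
        simp only [lineDeriv_mulTest]; ring
      have e2 : ∫ x, mulTest η φ x * pd u i x = ∫ x, φ x * (η x * pd u i x) :=
        integral_congr_ae (Eventually.of_forall fun x => by
          simp only [mulTest_apply]; ring)
      simp only [mul_add]
      rw [integral_add i3 i2]
      linarith)

theorem fn_mulH1 (η : Test n) (u : H1 n) :
    fn (mulH1 η u) =ᵐ[volume] fun x => η x * fn u x :=
  fn_mkH1 _ _ _

theorem pd_mulH1 (η : Test n) (u : H1 n) (i : Fin n) :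
    pd (mulH1 η u) i =ᵐ[volume]
      fun x => η x * pd u i x + (∂_{e i} η : Test n) x * fn u x :=
  coe_pd_mkH1 _ _ _ i

/-- The inclusion of the test functions in `ℋ¹`, as a linear map. -/
def testLin (n : ℕ) : Test n →ₗ[ℝ] H1 n where
  toFun := testToH1
  map_add' φ ψ := by
    refine Subtype.ext ((WithLp.equiv 2 _).injective (Prod.ext rfl (PiLp.ext fun i => ?_)))
    change (memLp_test (∂_{e i} (φ + ψ))).toLp _ = _
    simp only [LineDeriv.lineDerivOp_add]
    rfl
  map_smul' c φ := by
    refine Subtype.ext ((WithLp.equiv 2 _).injective (Prod.ext rfl (PiLp.ext fun i => ?_)))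
    change (memLp_test (∂_{e i} (c • φ))).toLp _ = _
    simp only [LineDeriv.lineDerivOp_smul]
    rfl

theorem tendsto_Lp_of_tendsto_eLpNorm {μ : Measure (E n)} {f : ℕ → E n → ℝ} (F : ℕ → Lp ℝ 2 μ)
    (G : Lp ℝ 2 μ) {g : E n → ℝ} (hF : ∀ m, F m =ᵐ[μ] f m) (hG : G =ᵐ[μ] g)
    (h : Tendsto (fun m => eLpNorm (fun x => f m x - g x) 2 μ) atTop (𝓝 0)) :
    Tendsto F atTop (𝓝 G) := by
  rw [tendsto_iff_dist_tendsto_zero]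
  have h1 : ∀ m, dist (F m) G = (eLpNorm (fun x => f m x - g x) 2 μ).toReal := by
    intro m
    rw [Lp.dist_def]
    refine congrArg _ (eLpNorm_congr_ae ?_)
    filter_upwards [hF m, hG] with x hx hx'
    simp [hx, hx']
  simp only [h1]
  exact (ENNReal.tendsto_toReal ENNReal.zero_ne_top).comp h

theorem tendsto_H1_of_tendsto {F : ℕ → H1 n} {u : H1 n}
    (h0 : Tendsto (fun m => fn (F m)) atTop (𝓝 (fn u)))
    (h1 : ∀ i, Tendsto (fun m => pd (F m) i) atTop (𝓝 (pd u i))) :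
    Tendsto F atTop (𝓝 u) := by
  rw [tendsto_iff_norm_sub_tendsto_zero]
  have h2 : Tendsto (fun m => ‖F m - u‖ ^ 2) atTop (𝓝 0) := by
    have hsum : Tendsto (fun m => ‖fn (F m) - fn u‖ ^ 2 + ∑ i, ‖pd (F m) i - pd u i‖ ^ 2) atTop
        (𝓝 (0 ^ 2 + ∑ _i : Fin n, 0 ^ 2)) :=
      ((tendsto_iff_norm_sub_tendsto_zero.1 h0).pow 2).add
        (tendsto_finsetSum _ fun i _ => (tendsto_iff_norm_sub_tendsto_zero.1 (h1 i)).pow 2)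
    simp only [ne_eq, OfNat.ofNat_ne_zero, not_false_eq_true, zero_pow, Finset.sum_const_zero,
      add_zero] at hsum
    refine hsum.congr fun m => ?_
    rw [H1_norm_sq]
    rfl
  have h3 := h2.sqrt
  simpa [Real.sqrt_sq] using h3

/-- An element of `ℋ¹` of compact support is the limit of its mollifications. -/
theorem mem_closure_testToH1 {v : H1 n} {w : E n → ℝ} (hvw : fn v =ᵐ[volume] w)
    (hw : MemLp w 2 volume) (hc : HasCompactSupport w) :
    v ∈ closure (Set.range (testToH1 : Test n → H1 n)) := by
  have hloc := hw.locallyIntegrable (by norm_num)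
  obtain ⟨T, hT⟩ : ∃ T : ℕ → Test n, ∀ m, ⇑(T m) = conv w (mollifier n m) :=
    ⟨fun m => mkTest (conv w (mollifier n m))
      (contDiff_conv hloc _) (hc.convolution _ (mollifier n m).hasCompactSupport), fun m => rfl⟩
  refine mem_closure_of_tendsto (f := fun m => testToH1 (T m)) (b := atTop) ?_
    (Eventually.of_forall fun m => ⟨T m, rfl⟩)
  refine tendsto_H1_of_tendsto ?_ fun i => ?_
  · have hvw' : fn v =ᵐ[weightedVolume n] w :=
      (weightedVolume_le n).absolutelyContinuous.ae_le hvw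
    refine tendsto_Lp_of_tendsto_eLpNorm (f := fun m => T m) (g := w) (fun m => fn (testToH1 (T m)))
      (fn v) (fun m => MemLp.coeFn_toLp (memLp_test_weighted (T m))) hvw' ?_
    simp only [hT]
    exact tendsto_of_tendsto_of_tendsto_of_le_of_le tendsto_const_nhds
      (tendsto_eLpNorm_conv_mollifier hw) (fun _ => zero_le)
      fun m => eLpNorm_mono_measure _ (weightedVolume_le n)
  · refine tendsto_Lp_of_tendsto_eLpNorm (f := fun m => conv (pd v i) (mollifier n m))
      (g := pd v i) _ _ (fun m => ?_) EventuallyEq.rfl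
      (tendsto_eLpNorm_conv_mollifier (Lp.memLp _))
    refine (coe_pd_testToH1 (T m) i).trans (Eventually.of_forall fun x => ?_)
    rw [lineDeriv_test_apply, ← fderiv_conv_fn v, conv_congr hvw, hT]

/-- Smooth cut-off functions, equal to one on the ball of radius `m + 1`, whose gradients are
bounded by multiples of both `1 / (m + 1)` and `ρ⁻¹`. -/
theorem exists_cutoff (n : ℕ) : ∃ (η : ℕ → Test n) (C : ℝ),
    (∀ m x, |η m x| ≤ 1) ∧ (∀ x, ∀ᶠ m in atTop, η m x = 1) ∧
    (∀ (i : Fin n) m x, |(∂_{e i} (η m) : Test n) x| ≤ C / (m + 1)) ∧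
    (∀ (i : Fin n) m x, |(∂_{e i} (η m) : Test n) x| ≤ 3 * C * (rho x)⁻¹) := by
  let χ : ContDiffBump (0 : E n) := ⟨1, 2, one_pos, one_lt_two⟩
  have hχ : ContDiff ℝ ∞ χ := χ.contDiff
  obtain ⟨C, hC⟩ := (χ.hasCompactSupport.fderiv ℝ).exists_bound_of_continuous
    (hχ.continuous_fderiv (by simp))
  have hC0 : 0 ≤ C := (norm_nonneg _).trans (hC 0)
  have hpos : ∀ m : ℕ, (0 : ℝ) < m + 1 := fun m => by positivity
  let η : ℕ → Test n := fun m => mkTest (fun x => χ ((m + 1 : ℝ)⁻¹ • x))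
    (hχ.comp (contDiff_const_smul _))
    (χ.hasCompactSupport.comp_smul (inv_ne_zero (hpos m).ne'))
  have hd : ∀ (i : Fin n) m x, (∂_{e i} (η m) : Test n) x =
      (m + 1 : ℝ)⁻¹ * fderiv ℝ χ ((m + 1 : ℝ)⁻¹ • x) (e i) := by
    intro i m x
    rw [lineDeriv_test_apply]
    have h1 : HasFDerivAt (fun y : E n => (m + 1 : ℝ)⁻¹ • y)
        ((m + 1 : ℝ)⁻¹ • ContinuousLinearMap.id ℝ (E n)) x :=
      (hasFDerivAt_id (𝕜 := ℝ) x).const_smul (m + 1 : ℝ)⁻¹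
    have h2 : HasFDerivAt χ (fderiv ℝ χ ((m + 1 : ℝ)⁻¹ • x)) ((m + 1 : ℝ)⁻¹ • x) :=
      (hχ.differentiable (by simp) _).hasFDerivAt
    have h3 : HasFDerivAt (η m) _ x := h2.comp x h1
    rw [h3.fderiv]
    simp
  have hb : ∀ (i : Fin n) m x, |(∂_{e i} (η m) : Test n) x| ≤ C / (m + 1) := by
    intro i m x
    rw [hd, abs_mul, abs_of_pos (inv_pos.2 (hpos m)), div_eq_inv_mul]
    refine mul_le_mul_of_nonneg_left ?_ (inv_pos.2 (hpos m)).le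
    refine ((fderiv ℝ χ _).le_opNorm (e i)).trans ?_
    simpa using hC ((m + 1 : ℝ)⁻¹ • x)
  refine ⟨η, C, fun m x => ?_, fun x => ?_, hb, fun i m x => ?_⟩
  · change |χ _| ≤ 1
    rw [abs_of_nonneg χ.nonneg]
    exact χ.le_one
  · obtain ⟨m₀, hm₀⟩ := exists_nat_ge ‖x‖
    filter_upwards [eventually_ge_atTop m₀] with m hm
    refine χ.one_of_mem_closedBall ?_
    have : (m₀ : ℝ) ≤ m := by exact_mod_cast hm
    simp only [mem_closedBall_zero_iff, norm_smul, norm_inv, Real.norm_eq_abs,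
      abs_of_pos (hpos m)]
    change (m + 1 : ℝ)⁻¹ * ‖x‖ ≤ 1
    rw [inv_mul_le_iff₀ (hpos m)]
    linarith
  · by_cases hx : ‖x‖ ≤ 2 * (m + 1)
    · refine (hb i m x).trans ?_
      -- on the support of the gradient, `ρ ≤ 1 + |x| ≤ 3 (m + 1)`
      have h3 : rho x ≤ 3 * (m + 1) := by
        refine Real.sqrt_le_iff.2 ⟨by positivity, ?_⟩
        have hm : (0 : ℝ) ≤ m := Nat.cast_nonneg m
        nlinarith [norm_nonneg x]
      have hr := rho_pos x
      rw [← div_eq_mul_inv, div_le_div_iff₀ (hpos m) hr]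
      nlinarith
    · have : (∂_{e i} (η m) : Test n) x = 0 := by
        rw [hd]
        have hz : fderiv ℝ χ ((m + 1 : ℝ)⁻¹ • x) = 0 := by
          refine image_eq_zero_of_notMem_tsupport fun hmem => hx ?_
          have h1 := tsupport_fderiv_subset ℝ hmem
          rw [χ.tsupport_eq] at h1
          simp only [mem_closedBall_zero_iff, norm_smul, norm_inv, Real.norm_eq_abs,
            abs_of_pos (hpos m)] at h1
          change (m + 1 : ℝ)⁻¹ * ‖x‖ ≤ 2 at h1
          rw [inv_mul_le_iff₀ (hpos m)] at h1
          linarith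
        rw [hz]; simp
      rw [this, abs_zero]
      have := rho_pos x
      positivity

/-- The cut-offs `η_m u` converge to `u` weakly in `ℋ¹`. -/
theorem tendsto_inner_mulH1 {η : ℕ → Test n} {C : ℝ} (h1 : ∀ m x, |η m x| ≤ 1)
    (h2 : ∀ x, ∀ᶠ m in atTop, η m x = 1)
    (h3 : ∀ (i : Fin n) m x, |(∂_{e i} (η m) : Test n) x| ≤ C / (m + 1))
    (h4 : ∀ (i : Fin n) m x, |(∂_{e i} (η m) : Test n) x| ≤ 3 * C * (rho x)⁻¹) (w u : H1 n) :
    Tendsto (fun m => ⟪w, mulH1 (η m) u⟫) atTop (𝓝 ⟪w, u⟫) := by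
  simp only [H1_inner]
  have hη : ∀ x, Tendsto (fun m => η m x) atTop (𝓝 1) := fun x =>
    tendsto_const_nhds.congr' ((h2 x).mono fun m hm => hm.symm)
  refine Tendsto.add ?_ (tendsto_finsetSum _ fun i _ => ?_)
  · have hi : Integrable (fun x => ((rho x)⁻¹ * fn w x) * ((rho x)⁻¹ * fn u x)) volume :=
      (memLp_rho_inv_mul_fn w).integrable_mul (memLp_rho_inv_mul_fn u)
    have e1 : ∀ m, ⟪fn w, fn (mulH1 (η m) u)⟫ =
        ∫ x, η m x * (((rho x)⁻¹ * fn w x) * ((rho x)⁻¹ * fn u x)) := by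
      intro m
      rw [L2w_inner_eq_integral]
      refine integral_congr_ae ((fn_mulH1 (η m) u).mono fun x hx => ?_)
      simp only [hx, ← inv_pow]; ring
    have e2 : ⟪fn w, fn u⟫ =
        ∫ x, 1 * (((rho x)⁻¹ * fn w x) * ((rho x)⁻¹ * fn u x)) := by
      rw [L2w_inner_eq_integral]
      refine integral_congr_ae (Eventually.of_forall fun x => ?_)
      simp only [← inv_pow]; ring
    simp only [e1, e2]
    refine tendsto_integral_of_dominated_convergence _
      (fun m => (η m).continuous.aestronglyMeasurable.mul hi.1) hi.norm
      (fun m => Eventually.of_forall fun x => ?_)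
      (Eventually.of_forall fun x => (hη x).mul_const _)
    rw [norm_mul]
    exact mul_le_of_le_one_left (norm_nonneg _) (h1 m x)
  · have hi : Integrable (fun x => pd w i x * pd u i x) volume :=
      (Lp.memLp (pd w i)).integrable_mul (Lp.memLp (pd u i))
    have hj : Integrable (fun x => pd w i x * ((rho x)⁻¹ * fn u x)) volume :=
      (Lp.memLp (pd w i)).integrable_mul (memLp_rho_inv_mul_fn u)
    have hm : AEStronglyMeasurable (fun x => pd w i x * fn u x) volume :=
      (Lp.aestronglyMeasurable _).mul (locallyIntegrable_fn u).aestronglyMeasurable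
    have e1 : ∀ m, ⟪pd w i, pd (mulH1 (η m) u) i⟫ =
        ∫ x, (η m x * (pd w i x * pd u i x) +
          (∂_{e i} (η m) : Test n) x * (pd w i x * fn u x)) := by
      intro m
      rw [L2_inner_eq_integral]
      refine integral_congr_ae ((pd_mulH1 (η m) u i).mono fun x hx => ?_)
      simp only [hx]; ring
    have e2 : ⟪pd w i, pd u i⟫ =
        ∫ x, (1 * (pd w i x * pd u i x) + 0 * (pd w i x * fn u x)) := by
      rw [L2_inner_eq_integral]
      simp
    simp only [e1, e2]
    have hd0 : ∀ x, Tendsto (fun m => (∂_{e i} (η m) : Test n) x) atTop (𝓝 0) := by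
      intro x
      refine squeeze_zero_norm (fun m => h3 i m x) ?_
      simpa [div_eq_mul_inv] using
        (tendsto_one_div_add_atTop_nhds_zero_nat (𝕜 := ℝ)).const_mul C
    refine tendsto_integral_of_dominated_convergence
      (fun x => ‖pd w i x * pd u i x‖ + 3 * C * ‖pd w i x * ((rho x)⁻¹ * fn u x)‖)
      (fun m => ((η m).continuous.aestronglyMeasurable.mul hi.1).add
        ((∂_{e i} (η m) : Test n).continuous.aestronglyMeasurable.mul hm))
      (hi.norm.add (hj.norm.const_mul _))
      (fun m => Eventually.of_forall fun x => ?_)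
      (Eventually.of_forall fun x => ((hη x).mul_const _).add ((hd0 x).mul_const _))
    refine (norm_add_le _ _).trans (add_le_add ?_ ?_)
    · rw [norm_mul]
      exact mul_le_of_le_one_left (norm_nonneg _) (h1 m x)
    · have hr := rho_pos x
      have := mul_le_mul_of_nonneg_right (h4 i m x) (norm_nonneg (pd w i x * fn u x))
      rw [norm_mul]
      refine this.trans (le_of_eq ?_)
      simp only [norm_mul, norm_inv, Real.norm_eq_abs, abs_of_pos hr]
      ring

/-- A linear map into a Hilbert space has dense range if only zero is orthogonal to it. The
hypothesis on `w` concerns the closure, so that limits of elements of the range may be used. -/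
theorem denseRange_of_forall_inner_eq_zero {T H : Type*} [AddCommGroup T] [Module ℝ T]
    [NormedAddCommGroup H] [InnerProductSpace ℝ H] [CompleteSpace H] (L : T →ₗ[ℝ] H)
    (h : ∀ w : H, (∀ v ∈ closure (Set.range L), ⟪w, v⟫ = 0) → w = 0) : DenseRange L := by
  have hcl : (L.range.topologicalClosure : Set H) = closure (Set.range L) := by
    rw [Submodule.topologicalClosure_coe, LinearMap.coe_range]
  have htop : L.range.topologicalClosure = ⊤ := by
    rw [Submodule.topologicalClosure_eq_top_iff, Submodule.eq_bot_iff]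
    intro w hw
    refine h w fun v hv => ?_
    rw [← hcl] at hv
    rw [← Submodule.orthogonal_closure] at hw
    exact Submodule.inner_left_of_mem_orthogonal hv hw
  rw [DenseRange, dense_iff_closure_eq, ← hcl, htop]
  rfl

/-- The test functions are dense in `ℋ¹`. -/
theorem denseRange_testToH1 (n : ℕ) : DenseRange (testToH1 : Test n → H1 n) := by
  refine denseRange_of_forall_inner_eq_zero (T := Test n) (H := H1 n) (testLin n) fun w hw => ?_
  obtain ⟨η, C, h1, h2, h3, h4⟩ := exists_cutoff n
  have hlim := tendsto_inner_mulH1 h1 h2 h3 h4 w w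
  have hz : ∀ m, ⟪w, mulH1 (η m) w⟫ = 0 := fun m =>
    hw _ (mem_closure_testToH1 (fn_mulH1 (η m) w) (memLp_test_mul_L2w _ (Lp.memLp (fn w)))
      (η m).hasCompactSupport.mul_right)
  simp only [hz] at hlim
  exact inner_self_eq_zero.1 (tendsto_nhds_unique hlim tendsto_const_nhds)

/-! ### Hardy's inequality and the divergence operator -/

theorem inner_pd_testToH1 (φ : Test n) (i : Fin n) (f : L2 n) :
    ⟪pd (testToH1 φ) i, f⟫ = ∫ x, (∂_{e i} φ : Test n) x * f x :=
  (integral_test_mul_L2 (∂_{e i} φ) f).symm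

/-- Integration by parts of a smooth function against a test function. -/
theorem integral_lineDeriv_mul_smooth (φ : Test n) {g : E n → ℝ} (hg : ContDiff ℝ ∞ g)
    (i : Fin n) :
    ∫ x, (∂_{e i} φ : Test n) x * g x = -∫ x, φ x * fderiv ℝ g x (e i) := by
  have hg' : Continuous fun x => fderiv ℝ g x (e i) :=
    (hg.continuous_fderiv (by simp)).clm_apply continuous_const
  have h1 := integrable_test_mul hg.continuous.locallyIntegrable (∂_{e i} φ)
  have h2 := integrable_test_mul hg'.locallyIntegrable φ
  have h3 := integrable_test_mul hg.continuous.locallyIntegrable φ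
  simp only [lineDeriv_test_apply] at h1 ⊢
  rw [integral_mul_fderiv_eq_neg_fderiv_mul_of_integrable h1 h2 h3
      (fun x _ => (φ.contDiff.differentiable (by simp)).differentiableAt)
      (fun x _ => (hg.differentiable (by simp)).differentiableAt), neg_neg]

/-- The `i`-th component of the vector field `x / ρ²`. -/
def hardyField (i : Fin n) (x : E n) : ℝ := x i * (rho x ^ 2)⁻¹

theorem contDiff_hardyField (i : Fin n) : ContDiff ℝ ∞ (hardyField i) :=
  (EuclideanSpace.proj (𝕜 := ℝ) i).contDiff.mul
    (contDiff_rho_sq.inv fun x => (rho_sq_pos x).ne')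

theorem fderiv_hardyField (i : Fin n) (x : E n) :
    fderiv ℝ (hardyField i) x (e i) = (rho x ^ 2)⁻¹ - 2 * x i ^ 2 * ((rho x ^ 2)⁻¹) ^ 2 := by
  have h0 := (rho_sq_pos x).ne'
  have h1 : HasFDerivAt (fun y : E n => y i) (EuclideanSpace.proj (𝕜 := ℝ) i) x :=
    (EuclideanSpace.proj (𝕜 := ℝ) i).hasFDerivAt
  have h2 : HasFDerivAt (fun y : E n => rho y ^ 2) (2 • innerSL ℝ x) x := by
    simp only [rho_sq]
    exact (hasStrictFDerivAt_norm_sq x).hasFDerivAt.const_add 1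
  have h3 : HasFDerivAt (hardyField i) _ x :=
    h1.mul ((hasDerivAt_inv h0).comp_hasFDerivAt x h2)
  have hin : ⟪x, e i⟫ = x i := by simp [e, EuclideanSpace.inner_single_right]
  rw [h3.fderiv]
  simp [hin]
  field_simp
  ring

theorem sum_sq_coord (x : E n) : ∑ i, x i ^ 2 = rho x ^ 2 - 1 := by
  rw [rho_sq, EuclideanSpace.real_norm_sq_eq]
  ring

/-- The pointwise inequality behind Hardy's inequality, with `t = φ(x)` and `d = ∇φ(x)`: the
divergence of `φ² x / ρ²` is bounded below by `φ² / (2 ρ²) - 2 |∇φ|²` in dimension at least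
three. -/
theorem hardy_pointwise (hn : 3 ≤ n) (x : E n) (t : ℝ) (d : Fin n → ℝ) :
    1 / 2 * ((rho x ^ 2)⁻¹ * t ^ 2) - 2 * ∑ i, d i ^ 2 ≤
      ∑ i, ((t * t) * ((rho x ^ 2)⁻¹ - 2 * x i ^ 2 * ((rho x ^ 2)⁻¹) ^ 2) +
        (t * d i + d i * t) * (x i * (rho x ^ 2)⁻¹)) := by
  have hr := rho_sq_pos x
  have hs := sum_sq_coord x
  have hr1 : 1 ≤ rho x ^ 2 := by rw [rho_sq]; nlinarith [sq_nonneg ‖x‖]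
  set r := rho x ^ 2
  have hterm : ∀ i, (t * t) * r⁻¹ - 5 / 2 * ((t ^ 2 * (r⁻¹) ^ 2) * x i ^ 2) - 2 * d i ^ 2 ≤
      (t * t) * (r⁻¹ - 2 * x i ^ 2 * (r⁻¹) ^ 2) + (t * d i + d i * t) * (x i * r⁻¹) := by
    intro i
    -- `2 t dᵢ xᵢ / r ≥ -(t xᵢ / r)² / 2 - 2 dᵢ²`
    nlinarith [sq_nonneg (t * x i * r⁻¹ + 2 * d i)]
  refine le_trans ?_ (Finset.sum_le_sum fun i _ => hterm i)
  simp only [Finset.sum_sub_distrib, ← Finset.mul_sum, hs]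
  simp only [Finset.sum_const, Finset.card_univ, Fintype.card_fin, nsmul_eq_mul]
  have hn' : (3 : ℝ) ≤ n := by exact_mod_cast hn
  have hri : r⁻¹ * r = 1 := inv_mul_cancel₀ hr.ne'
  have hp : 0 ≤ t ^ 2 * r⁻¹ := by positivity
  have hq : 0 ≤ t ^ 2 * r⁻¹ ^ 2 := by positivity
  have e1 : t ^ 2 * r⁻¹ ^ 2 * (r - 1) = t ^ 2 * r⁻¹ - t ^ 2 * r⁻¹ ^ 2 := by
    rw [mul_sub, mul_one, sq r⁻¹, ← mul_assoc, mul_assoc _ r⁻¹ r, hri, mul_one]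
  rw [e1]
  nlinarith [mul_nonneg (sub_nonneg.2 hn') hp]

theorem hardy_test (hn : 3 ≤ n) (φ : Test n) :
    ‖fn (testToH1 φ)‖ ^ 2 ≤ 4 * ∑ i, ‖pd (testToH1 φ) i‖ ^ 2 := by
  have hfn : fn (testToH1 φ) =ᵐ[volume] φ :=
    (volume_ac n).ae_le (MemLp.coeFn_toLp (memLp_test_weighted φ))
  have e0 : ‖fn (testToH1 φ)‖ ^ 2 = ∫ x, (rho x ^ 2)⁻¹ * φ x ^ 2 := by
    rw [← real_inner_self_eq_norm_sq, L2w_inner_eq_integral]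
    exact integral_congr_ae (hfn.mono fun x hx => by simp only [hx, sq])
  have e1 : ∀ i, ‖pd (testToH1 φ) i‖ ^ 2 = ∫ x, (∂_{e i} φ : Test n) x ^ 2 := by
    intro i
    rw [← real_inner_self_eq_norm_sq, inner_pd_testToH1]
    exact integral_congr_ae ((coe_pd_testToH1 φ i).mono fun x hx => by simp only [hx, sq])
  have i0 : Integrable (fun x => (rho x ^ 2)⁻¹ * φ x ^ 2) volume :=
    integrable_weightedVolume_iff.1 (memLp_test_weighted φ).integrable_sq
  have i1 : ∀ i : Fin n, Integrable (fun x => (∂_{e i} φ : Test n) x ^ 2) volume :=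
    fun i => (memLp_test (∂_{e i} φ)).integrable_sq
  have hF' : ∀ i : Fin n, Continuous fun x => fderiv ℝ (hardyField i) x (e i) := fun i =>
    ((contDiff_hardyField i).continuous_fderiv (by simp)).clm_apply continuous_const
  have i2 := fun i : Fin n => integrable_test_mul (hF' i).locallyIntegrable (mulTest φ φ)
  have i3 := fun i : Fin n =>
    integrable_test_mul (contDiff_hardyField i).continuous.locallyIntegrable (∂_{e i} (mulTest φ φ))
  have i4 : ∀ i : Fin n, Integrable (fun x => mulTest φ φ x * fderiv ℝ (hardyField i) x (e i) +
      (∂_{e i} (mulTest φ φ) : Test n) x * hardyField i x) volume := fun i => (i2 i).add (i3 i)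
  have hzero : ∫ x, ∑ i, (mulTest φ φ x * fderiv ℝ (hardyField i) x (e i) +
      (∂_{e i} (mulTest φ φ) : Test n) x * hardyField i x) = 0 := by
    rw [integral_finsetSum _ fun i _ => i4 i]
    refine Finset.sum_eq_zero fun i _ => ?_
    rw [integral_add (i2 i) (i3 i), integral_lineDeriv_mul_smooth _ (contDiff_hardyField i)]
    ring
  have i5 : Integrable (fun x => ∑ i, (∂_{e i} φ : Test n) x ^ 2) volume :=
    integrable_finsetSum _ fun i _ => i1 i
  have hle : ∫ x, (1 / 2 * ((rho x ^ 2)⁻¹ * φ x ^ 2) -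
      2 * ∑ i : Fin n, (∂_{e i} φ : Test n) x ^ 2) ≤ 0 := by
    rw [← hzero]
    refine integral_mono ((i0.const_mul _).sub (i5.const_mul _))
      (integrable_finsetSum _ fun i _ => i4 i) fun x => ?_
    simp only [fderiv_hardyField, lineDeriv_mulTest, mulTest_apply]
    exact hardy_pointwise hn x (φ x) fun i => (∂_{e i} φ : Test n) x
  rw [integral_sub (i0.const_mul _) (i5.const_mul _),
    integral_const_mul, integral_const_mul, integral_finsetSum _ fun i _ => i1 i, ← e0] at hle
  simp only [← e1] at hle
  linarith

theorem continuous_fn : Continuous (fn : H1 n → L2w n) := (fnL n).continuous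

theorem continuous_pd (i : Fin n) : Continuous fun u : H1 n => pd u i := (pdL i).continuous

/-- **Hardy's inequality** in `ℋ¹`. -/
theorem hardy (hn : 3 ≤ n) (u : H1 n) : ‖fn u‖ ^ 2 ≤ 4 * ∑ i, ‖pd u i‖ ^ 2 := by
  refine (denseRange_testToH1 n).induction_on (p := fun u : H1 n =>
    ‖fn u‖ ^ 2 ≤ 4 * ∑ i, ‖pd u i‖ ^ 2) u (isClosed_le ?_ ?_) (hardy_test hn)
  · exact continuous_fn.norm.pow 2
  · exact continuous_const.mul (continuous_finsetSum _ fun i _ => (continuous_pd i).norm.pow 2)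

/-- Two integrations by parts: `∫ ∂ᵢu ∂ⱼv = ∫ ∂ⱼu ∂ᵢv`. -/
theorem inner_pd_comm (u v : H1 n) (i j : Fin n) :
    ⟪pd u i, pd v j⟫ = ⟪pd u j, pd v i⟫ := by
  refine (denseRange_testToH1 n).induction_on (p := fun u : H1 n =>
    ⟪pd u i, pd v j⟫ = ⟪pd u j, pd v i⟫) u (isClosed_eq ?_ ?_) fun φ => ?_
  · exact (continuous_pd i).inner continuous_const
  · exact (continuous_pd j).inner continuous_const
  · rw [inner_pd_testToH1, inner_pd_testToH1, ← neg_inj, ← integral_lineDeriv_mul_fn,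
      ← integral_lineDeriv_mul_fn, lineDeriv_test_comm]

/-- The divergence `ℋ¹(ℝⁿ)ⁿ → L₂(ℝⁿ)`. -/
def divL (n : ℕ) : H1Vec n →L[ℝ] L2 n :=
  ∑ i, (pdL i).comp (PiLp.proj 2 (fun _ : Fin n => H1 n) i)

theorem divL_apply (v : H1Vec n) : divL n v = ∑ i, pd (v i) i := by
  simp [divL]

/-- `∑ ∫ ∂ᵢv_j ∂_jv_i = ‖div v‖²`. -/
theorem sum_inner_pd_transpose (v : H1Vec n) :
    ∑ j, ∑ i, ⟪pd (v j) i, pd (v i) j⟫ = ‖divL n v‖ ^ 2 := by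
  rw [← real_inner_self_eq_norm_sq, divL_apply, sum_inner]
  refine Finset.sum_congr rfl fun j _ => ?_
  rw [inner_sum]
  exact Finset.sum_congr rfl fun i _ => inner_pd_comm _ _ _ _

/-- By Hardy's inequality the gradient controls the norm of `ℋ¹(ℝⁿ)ⁿ`. -/
theorem H1Vec_norm_sq_le (hn : 3 ≤ n) (v : H1Vec n) :
    ‖v‖ ^ 2 ≤ 5 * ∑ j, ∑ i, ‖pd (v j) i‖ ^ 2 := by
  rw [H1Vec_norm_sq, Finset.mul_sum]
  refine Finset.sum_le_sum fun j _ => ?_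
  linarith [hardy hn (v j)]

/-- The gradient of a test function, as an element of `ℋ¹(ℝⁿ)ⁿ`. -/
def gradLin (n : ℕ) : Test n →ₗ[ℝ] H1Vec n :=
  (WithLp.linearEquiv 2 ℝ (Fin n → H1 n)).symm.toLinearMap ∘ₗ
    LinearMap.pi fun j => testLin n ∘ₗ (TestFunction.lineDerivCLM ℝ (e j)).toLinearMap

@[simp]
theorem gradLin_apply (φ : Test n) (j : Fin n) :
    gradLin n φ j = testToH1 (∂_{e j} φ) := rfl

theorem norm_gradLin_sq_le (hn : 3 ≤ n) (φ : Test n) :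
    ‖gradLin n φ‖ ^ 2 ≤ 5 * ‖divL n (gradLin n φ)‖ ^ 2 := by
  refine (H1Vec_norm_sq_le hn _).trans (le_of_eq ?_)
  rw [← sum_inner_pd_transpose]
  congr 1
  refine Finset.sum_congr rfl fun j _ => Finset.sum_congr rfl fun i _ => ?_
  have h : pd (testToH1 (∂_{e j} φ)) i = pd (testToH1 (∂_{e i} φ)) j := by
    rw [pd_testToH1, pd_testToH1]
    exact MemLp.toLp_congr _ _
      (Eventually.of_forall fun x => by rw [lineDeriv_test_comm])
  rw [gradLin_apply, gradLin_apply, ← h, real_inner_self_eq_norm_sq]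

/-- A convolution `h ⋆ k` with `h ∈ L₂`, as an element of `ℋ¹`. -/
def convH1 (h : L2 n) (k : Test n) : H1 n :=
  mkH1 (conv h k) (fun i => conv h (∂_{e i} k : Test n))
    ((memLp_conv (Lp.memLp h) k).mono_measure (weightedVolume_le n))
    (fun i => memLp_conv (Lp.memLp h) _)
    (fun i φ => by
      rw [integral_lineDeriv_mul_smooth φ (contDiff_conv (locallyIntegrable_L2 h) k)]
      simp only [fderiv_conv (locallyIntegrable_L2 h)])

/-- An `L₂` function orthogonal to the Laplacians of all test functions vanishes: its mollifications
are harmonic elements of `ℋ¹`, hence have zero energy. -/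
theorem eq_zero_of_forall_inner_laplacian (hn : 3 ≤ n) (h : L2 n)
    (hh : ∀ φ : Test n, ⟪h, divL n (gradLin n φ)⟫ = 0) : h = 0 := by
  have hlap : ∀ φ : Test n,
      ∑ i : Fin n, ∫ x, (∂_{e i} (∂_{e i} φ : Test n) : Test n) x * h x = 0 := by
    intro φ
    rw [← hh φ, divL_apply, inner_sum]
    refine Finset.sum_congr rfl fun i _ => ?_
    rw [gradLin_apply, real_inner_comm, inner_pd_testToH1]
  have hloc := locallyIntegrable_L2 h
  have hconv : ∀ k : Test n, conv h k =ᵐ[volume] 0 := by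
    intro k
    have hharm : ∀ x : E n, ∑ i : Fin n, conv h (∂_{e i} (∂_{e i} k : Test n) : Test n) x = 0 := by
      intro x
      rw [← hlap (reflectTest k x)]
      refine Finset.sum_congr rfl fun i _ => ?_
      rw [conv_apply]
      refine integral_congr_ae (Eventually.of_forall fun t => ?_)
      have : (∂_{e i} (∂_{e i} (reflectTest k x) : Test n) : Test n) =
          reflectTest (∂_{e i} (∂_{e i} k : Test n)) x := by
        rw [lineDeriv_reflectTest, LineDeriv.lineDerivOp_neg, lineDeriv_reflectTest, neg_neg]
      simp only [this, reflectTest_apply]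
      ring
    set U := convH1 h k with hU
    have hpd : ∀ i, pd U i =ᵐ[volume] conv h (∂_{e i} k : Test n) :=
      fun i => coe_pd_mkH1 _ _ _ i
    have htest : ∀ ψ : Test n, ∑ i, ⟪pd (testToH1 ψ) i, pd U i⟫ = 0 := by
      intro ψ
      have h1 : ∀ i, ⟪pd (testToH1 ψ) i, pd U i⟫ =
          -∫ x, ψ x * conv h (∂_{e i} (∂_{e i} k : Test n) : Test n) x := by
        intro i
        rw [inner_pd_testToH1, integral_congr_ae
          ((hpd i).mono fun x hx => congrArg ((∂_{e i} ψ : Test n) x * ·) hx),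
          integral_lineDeriv_mul_smooth ψ (contDiff_conv hloc _)]
        simp only [fderiv_conv hloc]
      simp only [h1]
      rw [Finset.sum_neg_distrib, ← integral_finsetSum _ fun i _ =>
        integrable_test_mul (contDiff_conv hloc _).continuous.locallyIntegrable ψ]
      simp only [← Finset.mul_sum, hharm]
      simp
    have hall : ∀ V : H1 n, ∑ i, ⟪pd V i, pd U i⟫ = 0 := fun V =>
      (denseRange_testToH1 n).induction_on (p := fun V : H1 n => ∑ i, ⟪pd V i, pd U i⟫ = 0) V
        (isClosed_eq (continuous_finsetSum _ fun i _ => (continuous_pd i).inner continuous_const)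
          continuous_const) htest
    -- tested with itself, the harmonic `U` has zero energy
    have hE := hall U
    simp only [real_inner_self_eq_norm_sq] at hE
    have h0 : ‖fn U‖ ^ 2 ≤ 0 := by simpa [hE] using hardy hn U
    have h1 : fn U = 0 := norm_eq_zero.1 (pow_eq_zero_iff two_ne_zero |>.1
      (le_antisymm h0 (sq_nonneg _)))
    have h2 : fn U =ᵐ[volume] conv h k := fn_mkH1 _ _ _
    have h3 : fn U =ᵐ[volume] 0 := by
      rw [h1]
      exact (volume_ac n).ae_le (Lp.coeFn_zero ℝ 2 (weightedVolume n))
    exact h2.symm.trans h3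
  have hlim := tendsto_eLpNorm_conv_mollifier (Lp.memLp h)
  have hconst : ∀ m, eLpNorm (fun x => conv h (mollifier n m) x - h x) 2 volume =
      eLpNorm h 2 volume := by
    intro m
    rw [← eLpNorm_neg (f := h)]
    refine eLpNorm_congr_ae ((hconv (mollifier n m)).mono fun x hx => ?_)
    simp [hx]
  simp only [hconst] at hlim
  have hz := tendsto_nhds_unique hlim tendsto_const_nhds
  rw [← norm_eq_zero, Lp.norm_def, ← hz]
  rfl

/-- The Laplacians of test functions are dense in `L₂`. -/
theorem denseRange_laplacian (hn : 3 ≤ n) :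
    DenseRange fun φ : Test n => divL n (gradLin n φ) :=
  denseRange_of_forall_inner_eq_zero (T := Test n) (H := L2 n)
    ((divL n).toLinearMap ∘ₗ gradLin n) fun w hw =>
      eq_zero_of_forall_inner_laplacian hn w fun φ => hw _ (subset_closure ⟨φ, rfl⟩)

/-! ### Saddle-point problems -/

section SaddlePoint

variable {V Q : Type*} [NormedAddCommGroup V] [InnerProductSpace ℝ V] [CompleteSpace V]
  [NormedAddCommGroup Q] [InnerProductSpace ℝ Q] [CompleteSpace Q]

/-- An operator with a bounded right inverse on a dense set satisfies the inf-sup condition. -/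
theorem norm_le_norm_adjoint {T : Type*} {B : V →L[ℝ] Q} {G : T → V} {κ : ℝ} (hκ : 0 ≤ κ)
    (hG : DenseRange fun t => B (G t)) (hGκ : ∀ t, ‖G t‖ ≤ κ * ‖B (G t)‖) (q : Q) :
    ‖q‖ ≤ κ * ‖B.adjoint q‖ := by
  have key : ∀ p : Q, ⟪q, p⟫ ≤ κ * ‖B.adjoint q‖ * ‖p‖ := fun p =>
    hG.induction_on (p := fun p : Q => ⟪q, p⟫ ≤ κ * ‖B.adjoint q‖ * ‖p‖) p
      (isClosed_le (continuous_const.inner continuous_id)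
        (continuous_const.mul continuous_norm)) fun t => by
        rw [← ContinuousLinearMap.adjoint_inner_left]
        refine (real_inner_le_norm _ _).trans ?_
        nlinarith [norm_nonneg (B.adjoint q), hGκ t]
  have h := key q
  rw [real_inner_self_eq_norm_sq] at h
  rcases (norm_nonneg q).eq_or_lt with h0 | h0
  · rw [← h0]; positivity
  · nlinarith

variable {A : V →L[ℝ] V →L[ℝ] ℝ} {B : V →L[ℝ] Q} {κ α M : ℝ}

/-- Under the inf-sup condition, `B B†` is onto, and so `B` has a bounded right inverse. -/
theorem exists_adjoint_lift (hκ : 0 < κ) (hB : ∀ q, ‖q‖ ≤ κ * ‖B.adjoint q‖) (g : Q) :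
    ∃ q : Q, B (B.adjoint q) = g ∧ ‖B.adjoint q‖ ≤ κ * ‖g‖ := by
  have hco : IsCoercive ((innerSL ℝ).comp (B.comp B.adjoint) : Q →L[ℝ] Q →L[ℝ] ℝ) := by
    refine ⟨(κ ^ 2)⁻¹, by positivity, fun q => ?_⟩
    change (κ ^ 2)⁻¹ * ‖q‖ * ‖q‖ ≤ ⟪B (B.adjoint q), q⟫
    rw [← ContinuousLinearMap.adjoint_inner_right, real_inner_self_eq_norm_sq, mul_assoc,
      inv_mul_le_iff₀ (by positivity), ← mul_pow, ← sq]
    exact pow_le_pow_left₀ (norm_nonneg _) (hB q) 2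
  obtain ⟨q, hq⟩ := hco.continuousLinearEquivOfBilin.surjective g
  have hBq : B (B.adjoint q) = g := by
    rw [← hq]
    refine ext_inner_right ℝ fun w => ?_
    exact (hco.continuousLinearEquivOfBilin_apply q w).symm
  refine ⟨q, hBq, ?_⟩
  have h1 : ‖B.adjoint q‖ ^ 2 = ⟪q, g⟫ := by
    rw [← hBq, ← ContinuousLinearMap.adjoint_inner_left, real_inner_self_eq_norm_sq]
  have h2 : ⟪q, g⟫ ≤ κ * ‖B.adjoint q‖ * ‖g‖ :=
    (real_inner_le_norm _ _).trans (mul_le_mul_of_nonneg_right (hB q) (norm_nonneg _))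
  rcases (norm_nonneg (B.adjoint q)).eq_or_lt with h0 | h0
  · rw [← h0]; positivity
  · nlinarith

/-- The stability constant of a saddle-point problem. -/
def saddleConst (κ α M : ℝ) : ℝ :=
  (κ + α⁻¹ * (1 + M * κ)) + κ * (1 + M * (κ + α⁻¹ * (1 + M * κ)))

/-- The a priori estimate for saddle-point problems. -/
theorem saddle_estimate (hκ : 0 < κ) (hα : 0 < α) (hM : 0 ≤ M)
    (hB : ∀ q, ‖q‖ ≤ κ * ‖B.adjoint q‖) (hA : ∀ u v, |A u v| ≤ M * ‖u‖ * ‖v‖)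
    (hco : ∀ v, B v = 0 → α * ‖v‖ ^ 2 ≤ A v v) {u : V} {p : Q} {l : V →L[ℝ] ℝ} {g : Q}
    (h1 : ∀ v, A u v + ⟪p, B v⟫ = l v) (h2 : B u = g) :
    ‖u‖ + ‖p‖ ≤ saddleConst κ α M * (‖l‖ + ‖g‖) := by
  obtain ⟨q, hq, hqn⟩ := exists_adjoint_lift hκ hB g
  set w := B.adjoint q
  have hl : ∀ v, |l v| ≤ ‖l‖ * ‖v‖ := fun v => l.le_opNorm v
  have hl0 := norm_nonneg l
  have hg0 := norm_nonneg g
  have hz : B (u - w) = 0 := by rw [map_sub, h2, hq, sub_self]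
  have hd : ‖u - w‖ ≤ α⁻¹ * (‖l‖ + M * (κ * ‖g‖)) := by
    have e1 : A (u - w) (u - w) = l (u - w) - A w (u - w) := by
      rw [← h1, hz, inner_zero_right, map_sub A u w, sub_apply]
      ring
    have e2 := hco _ hz
    have e3 := (abs_le.1 (hA w (u - w))).1
    have e4 := (abs_le.1 (hl (u - w))).2
    rw [le_inv_mul_iff₀ hα]
    have e5 : M * ‖w‖ * ‖u - w‖ ≤ M * (κ * ‖g‖) * ‖u - w‖ := by gcongr
    rcases (norm_nonneg (u - w)).eq_or_lt with h0 | h0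
    · rw [← h0, mul_zero]; positivity
    · nlinarith
  have hu : ‖u‖ ≤ (κ + α⁻¹ * (1 + M * κ)) * (‖l‖ + ‖g‖) := by
    have e1 : ‖u‖ ≤ ‖u - w‖ + ‖w‖ := by simpa using norm_add_le (u - w) w
    have e2 : 0 ≤ κ * ‖l‖ + α⁻¹ * (M * κ * ‖l‖ + ‖g‖) := by positivity
    nlinarith
  have hp : ‖p‖ ≤ κ * (‖l‖ + M * ‖u‖) := by
    refine (hB p).trans (mul_le_mul_of_nonneg_left ?_ hκ.le)
    have e1 : ‖B.adjoint p‖ ^ 2 = l (B.adjoint p) - A u (B.adjoint p) := by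
      rw [← h1, ← ContinuousLinearMap.adjoint_inner_left, real_inner_self_eq_norm_sq]
      ring
    have e3 := (abs_le.1 (hA u (B.adjoint p))).1
    have e4 := (abs_le.1 (hl (B.adjoint p))).2
    rcases (norm_nonneg (B.adjoint p)).eq_or_lt with h0 | h0
    · rw [← h0]; positivity
    · nlinarith
  have e6 : κ * (‖l‖ + M * ‖u‖) ≤
      κ * (1 + M * (κ + α⁻¹ * (1 + M * κ))) * (‖l‖ + ‖g‖) := by
    have e7 : M * ‖u‖ ≤ M * ((κ + α⁻¹ * (1 + M * κ)) * (‖l‖ + ‖g‖)) := by gcongr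
    rw [mul_assoc]
    refine mul_le_mul_of_nonneg_left ?_ hκ.le
    nlinarith
  rw [saddleConst, add_mul]
  linarith

/-- Solvability of saddle-point problems whose form is coercive on the kernel of the constraint. -/
theorem saddle_exists (hκ : 0 < κ) (hα : 0 < α) (hB : ∀ q, ‖q‖ ≤ κ * ‖B.adjoint q‖)
    (hco : ∀ v, B v = 0 → α * ‖v‖ ^ 2 ≤ A v v) (l : V →L[ℝ] ℝ) (g : Q) :
    ∃ (u : V) (p : Q), (∀ v, A u v + ⟪p, B v⟫ = l v) ∧ B u = g := by
  obtain ⟨q, hq, -⟩ := exists_adjoint_lift hκ hB g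
  set w := B.adjoint q
  let K : Submodule ℝ V := B.ker
  have hKc : IsClosed (K : Set V) := B.isClosed_ker
  have : CompleteSpace K := hKc.completeSpace_coe
  have hcoK : IsCoercive (A.bilinearComp K.subtypeL K.subtypeL : K →L[ℝ] K →L[ℝ] ℝ) := by
    refine ⟨α, hα, fun v => ?_⟩
    have := hco v v.2
    rw [sq, ← mul_assoc] at this
    exact this
  obtain ⟨z, hz⟩ := hcoK.continuousLinearEquivOfBilin.surjective
    ((InnerProductSpace.toDual ℝ K).symm ((l - A w).comp K.subtypeL))
  have hzv : ∀ v : K, A z v = l v - A w v := by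
    intro v
    have h1 := hcoK.continuousLinearEquivOfBilin_apply z v
    rw [hz, InnerProductSpace.toDual_symm_apply] at h1
    exact h1.symm
  -- the residual vanishes on `ker B`, hence lies in the range of `B†`
  set r : V := (InnerProductSpace.toDual ℝ V).symm (l - A (w + z)) with hr
  have hrv : ∀ v, ⟪r, v⟫ = l v - A (w + z) v := fun v => by
    rw [hr, InnerProductSpace.toDual_symm_apply]; rfl
  obtain ⟨p, hp, -⟩ := exists_adjoint_lift hκ hB (B r)
  have hrp : r = B.adjoint p := by
    have hmem : B (r - B.adjoint p) = 0 := by rw [map_sub, hp, sub_self]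
    have h0 : ⟪r - B.adjoint p, r - B.adjoint p⟫ = 0 := by
      have e1 : ⟪r, r - B.adjoint p⟫ = 0 := by
        rw [hrv, map_add, add_apply, hzv ⟨_, hmem⟩]
        ring
      rw [inner_sub_left, e1, ContinuousLinearMap.adjoint_inner_left, hmem, inner_zero_right,
        sub_zero]
    exact sub_eq_zero.1 (inner_self_eq_zero.1 h0)
  refine ⟨w + z, p, fun v => ?_, ?_⟩
  · rw [← ContinuousLinearMap.adjoint_inner_left, ← hrp, hrv]
    ring
  · rw [map_add, hq, show B z = 0 from z.2, add_zero]

end SaddlePoint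

/-! ### The viscous form and the weak formulation of the Stokes system -/

/-- Multiplication by an essentially bounded function on `L₂`. -/
def mulL {b : E n → ℝ} (hb : MemLp b ⊤ volume) : L2 n →L[ℝ] L2 n :=
  (ContinuousLinearMap.mul ℝ ℝ).holderL volume ⊤ 2 2 (hb.toLp b)

theorem coe_mulL {b : E n → ℝ} (hb : MemLp b ⊤ volume) (f : L2 n) :
    mulL hb f =ᵐ[volume] fun x => b x * f x := by
  refine ((ContinuousLinearMap.mul ℝ ℝ).coeFn_holder (hb.toLp b) f).trans
    (hb.coeFn_toLp.mono fun x hx => ?_)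
  simp only [hx, ContinuousLinearMap.mul_apply']

theorem norm_mulL_le {b : E n → ℝ} (hb : MemLp b ⊤ volume) {M : ℝ} (hM : 0 ≤ M)
    (hbM : eLpNorm b ⊤ volume ≤ ENNReal.ofReal M) (f : L2 n) : ‖mulL hb f‖ ≤ M * ‖f‖ := by
  refine ((ContinuousLinearMap.mul ℝ ℝ).norm_holder_apply_apply_le (hb.toLp b) f).trans ?_
  refine mul_le_mul_of_nonneg_right ?_ (norm_nonneg _)
  rw [Lp.norm_toLp]
  have h1 : ‖ContinuousLinearMap.mul ℝ ℝ‖ ≤ 1 := ContinuousLinearMap.opNorm_mul_le ℝ ℝ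
  have h2 := ENNReal.toReal_le_of_le_ofReal hM hbM
  nlinarith [ENNReal.toReal_nonneg (a := eLpNorm b ⊤ volume)]

/-- The symmetric gradient `E_{jβ}` as a continuous linear map to `L₂`. -/
def symGradL (j β : Fin n) : H1Vec n →L[ℝ] L2 n :=
  (1 / 2 : ℝ) • ((pdL j).comp (PiLp.proj 2 (fun _ : Fin n => H1 n) β) +
    (pdL β).comp (PiLp.proj 2 (fun _ : Fin n => H1 n) j))

theorem symGradL_apply (j β : Fin n) (u : H1Vec n) :
    symGradL j β u = (1 / 2 : ℝ) • (pd (u β) j + pd (u j) β) := rfl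

theorem coe_symGradL (j β : Fin n) (u : H1Vec n) :
    symGradL j β u =ᵐ[volume] symGrad u j β := by
  rw [symGradL_apply]
  filter_upwards [Lp.coeFn_smul (1 / 2 : ℝ) (pd (u β) j + pd (u j) β),
    Lp.coeFn_add (pd (u β) j) (pd (u j) β)] with x h1 h2
  rw [h1, Pi.smul_apply, h2, Pi.add_apply, symGrad, smul_eq_mul]
  ring

theorem norm_pd_le_norm (u : H1 n) (i : Fin n) : ‖pd u i‖ ≤ ‖u‖ := by
  refine abs_le_of_sq_le_sq' ?_ (norm_nonneg _) |>.2
  rw [H1_norm_sq]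
  have := Finset.single_le_sum (f := fun i => ‖pd u i‖ ^ 2) (fun i _ => sq_nonneg _)
    (Finset.mem_univ i)
  nlinarith [sq_nonneg ‖fn u‖]

theorem norm_pd_apply_le (u : H1Vec n) (i j : Fin n) : ‖pd (u i) j‖ ≤ ‖u‖ :=
  (norm_pd_le_norm _ _).trans (PiLp.norm_apply_le u i)

theorem norm_symGradL_apply_le (j β : Fin n) (u : H1Vec n) : ‖symGradL j β u‖ ≤ ‖u‖ := by
  rw [symGradL_apply, norm_smul]
  have h := norm_add_le (pd (u β) j) (pd (u j) β)
  have h1 := norm_pd_apply_le u β j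
  have h2 := norm_pd_apply_le u j β
  norm_num
  linarith

/-- The stress `∑_{jβ} a_{ij}^{αβ} E_{jβ}(u)`, an element of `L₂`. -/
def stressL {a : Tensor n} (ha : ∀ i j α β, MemLp (a i j α β) ⊤ volume) (i α : Fin n) :
    H1Vec n →L[ℝ] L2 n :=
  ∑ j, ∑ β, (mulL (ha i j α β)).comp (symGradL j β)

theorem stressL_apply {a : Tensor n} (ha : ∀ i j α β, MemLp (a i j α β) ⊤ volume) (i α : Fin n)
    (u : H1Vec n) : stressL ha i α u = ∑ j, ∑ β, mulL (ha i j α β) (symGradL j β u) := by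
  simp [stressL]

theorem coe_stressL {a : Tensor n} (ha : ∀ i j α β, MemLp (a i j α β) ⊤ volume) (i α : Fin n)
    (u : H1Vec n) :
    stressL ha i α u =ᵐ[volume] fun x => ∑ j, ∑ β, a i j α β x * symGrad u j β x := by
  have h1 : ∀ᵐ x, ∀ j β, mulL (ha i j α β) (symGradL j β u) x =
      a i j α β x * symGrad u j β x := by
    refine ae_all_iff.2 fun j => ae_all_iff.2 fun β => ?_
    filter_upwards [coe_mulL (ha i j α β) (symGradL j β u), coe_symGradL j β u] with x h1 h2
    rw [h1, h2]
  have h2 : stressL ha i α u =ᵐ[volume]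
      ∑ j, ∑ β, (mulL (ha i j α β) (symGradL j β u) : E n → ℝ) := by
    rw [stressL_apply]
    refine (Lp.coeFn_finsetSum _ _).trans ?_
    exact eventuallyEq_sum fun j _ => Lp.coeFn_finsetSum _ _
  filter_upwards [h1, h2] with x hx hx'
  rw [hx']
  simp only [Finset.sum_apply, hx]

theorem norm_stressL_apply_le {a : Tensor n} (ha : ∀ i j α β, MemLp (a i j α β) ⊤ volume)
    {M : ℝ} (hM : 0 ≤ M) (haM : ∀ i j α β, eLpNorm (a i j α β) ⊤ volume ≤ ENNReal.ofReal M)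
    (i α : Fin n) (u : H1Vec n) : ‖stressL ha i α u‖ ≤ n ^ 2 * M * ‖u‖ := by
  rw [stressL_apply]
  have h : ∀ j β, ‖mulL (ha i j α β) (symGradL j β u)‖ ≤ M * ‖u‖ := fun j β =>
    (norm_mulL_le _ hM (haM i j α β) _).trans
      (mul_le_mul_of_nonneg_left (norm_symGradL_apply_le j β u) hM)
  refine (norm_sum_le_of_le _ fun j _ => norm_sum_le_of_le _ fun β _ => h j β).trans (le_of_eq ?_)
  simp
  ring

/-- The viscous form `∑ ∫ a_{ij}^{αβ} E_{jβ}(u) ∂_αv_i`. -/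
def viscousForm {a : Tensor n} (ha : ∀ i j α β, MemLp (a i j α β) ⊤ volume) :
    H1Vec n →L[ℝ] H1Vec n →L[ℝ] ℝ :=
  ∑ i, ∑ α, (innerSL ℝ : L2 n →L[ℝ] L2 n →L[ℝ] ℝ).bilinearComp (stressL ha i α)
    ((pdL α).comp (PiLp.proj 2 (fun _ : Fin n => H1 n) i))

theorem viscousForm_apply {a : Tensor n} (ha : ∀ i j α β, MemLp (a i j α β) ⊤ volume)
    (u v : H1Vec n) : viscousForm ha u v = ∑ i, ∑ α, ⟪stressL ha i α u, pd (v i) α⟫ := by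
  simp [viscousForm]

theorem abs_viscousForm_le {a : Tensor n} (ha : ∀ i j α β, MemLp (a i j α β) ⊤ volume)
    {M : ℝ} (hM : 0 ≤ M) (haM : ∀ i j α β, eLpNorm (a i j α β) ⊤ volume ≤ ENNReal.ofReal M)
    (u v : H1Vec n) : |viscousForm ha u v| ≤ n ^ 4 * M * ‖u‖ * ‖v‖ := by
  rw [viscousForm_apply, ← Real.norm_eq_abs]
  have h : ∀ i α, ‖⟪stressL ha i α u, pd (v i) α⟫‖ ≤ n ^ 2 * M * ‖u‖ * ‖v‖ := fun i α =>
    (norm_inner_le_norm _ _).trans (mul_le_mul (norm_stressL_apply_le ha hM haM i α u)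
      (norm_pd_apply_le v i α) (norm_nonneg _) (by positivity))
  refine (norm_sum_le_of_le _ fun i _ => norm_sum_le_of_le _ fun α _ => h i α).trans (le_of_eq ?_)
  simp
  ring

/-- **Korn's inequality** for divergence-free fields. -/
theorem korn (v : H1Vec n) (hv : divL n v = 0) :
    ∑ i, ∑ α, ‖pd (v i) α‖ ^ 2 = 2 * ∑ i, ∑ α, ‖symGradL i α v‖ ^ 2 := by
  have h1 : ∀ i α, ‖symGradL i α v‖ ^ 2 = 1 / 4 * (‖pd (v α) i‖ ^ 2 + ‖pd (v i) α‖ ^ 2 +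
      2 * ⟪pd (v i) α, pd (v α) i⟫) := by
    intro i α
    rw [symGradL_apply, norm_smul, mul_pow, norm_add_sq_real, real_inner_comm]
    norm_num
    ring
  have h2 := sum_inner_pd_transpose v
  rw [hv, norm_zero] at h2
  have h3 : ∑ i, ∑ α, ‖pd (v α) i‖ ^ 2 = ∑ i, ∑ α, ‖pd (v i) α‖ ^ 2 := Finset.sum_comm
  simp only [h1, ← Finset.mul_sum, Finset.sum_add_distrib]
  rw [h3, h2]
  ring

theorem integrable_mul_L2 (f g : L2 n) : Integrable (fun x => f x * g x) volume :=
  (Lp.memLp f).integrable_mul (Lp.memLp g)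

theorem norm_sq_eq_integral (f : L2 n) : ‖f‖ ^ 2 = ∫ x, f x ^ 2 := by
  rw [← real_inner_self_eq_norm_sq, L2_inner_eq_integral]
  simp only [sq]

/-- The symmetric gradient of a divergence-free field is symmetric and trace-free, so that the
relaxed ellipticity condition applies to it. -/
theorem norm_symGradL_le_viscousForm {a : Tensor n} {c : ℝ} (ha : IsViscosityTensor a c)
    (v : H1Vec n) (hv : divL n v = 0) :
    c⁻¹ * ∑ i, ∑ α, ‖symGradL i α v‖ ^ 2 ≤ viscousForm ha.memLp v v := by
  have htr : ∀ᵐ x, ∑ i, symGrad v i i x = 0 := by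
    have h1 : (divL n v : E n → ℝ) =ᵐ[volume] ∑ i, (pd (v i) i : E n → ℝ) := by
      rw [divL_apply]; exact Lp.coeFn_finsetSum _ _
    rw [hv] at h1
    filter_upwards [h1, Lp.coeFn_zero ℝ 2 (volume : Measure (E n))] with x hx hx'
    rw [hx', Finset.sum_apply] at hx
    simp only [symGrad, add_self_div_two]
    exact hx.symm
  have hstress : ∀ᵐ x, ∀ i α, stressL ha.memLp i α v x =
      ∑ j, ∑ β, a i j α β x * symGrad v j β x :=
    ae_all_iff.2 fun i => ae_all_iff.2 fun α => coe_stressL ha.memLp i α v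
  have hsg : ∀ᵐ x, ∀ i α, symGradL i α v x = symGrad v i α x :=
    ae_all_iff.2 fun i => ae_all_iff.2 fun α => coe_symGradL i α v
  have i1 : Integrable (fun x => ∑ i, ∑ α, symGradL i α v x ^ 2) volume :=
    integrable_finsetSum _ fun i _ => integrable_finsetSum _ fun α _ =>
      (Lp.memLp (symGradL i α v)).integrable_sq
  have i2 : Integrable (fun x => ∑ i, ∑ α, stressL ha.memLp i α v x * pd (v i) α x) volume :=
    integrable_finsetSum _ fun i _ => integrable_finsetSum _ fun α _ => integrable_mul_L2 _ _
  have e1 : ∑ i, ∑ α, ‖symGradL i α v‖ ^ 2 = ∫ x, ∑ i, ∑ α, symGradL i α v x ^ 2 := by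
    rw [integral_finsetSum _ fun i _ => integrable_finsetSum _ fun α _ =>
      (Lp.memLp (symGradL i α v)).integrable_sq]
    refine Finset.sum_congr rfl fun i _ => ?_
    rw [integral_finsetSum _ fun α _ => (Lp.memLp (symGradL i α v)).integrable_sq]
    exact Finset.sum_congr rfl fun α _ => norm_sq_eq_integral _
  have e2 : viscousForm ha.memLp v v =
      ∫ x, ∑ i, ∑ α, stressL ha.memLp i α v x * pd (v i) α x := by
    rw [viscousForm_apply, integral_finsetSum _ fun i _ => integrable_finsetSum _ fun α _ =>
      integrable_mul_L2 _ _]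
    refine Finset.sum_congr rfl fun i _ => ?_
    rw [integral_finsetSum _ fun α _ => integrable_mul_L2 _ _]
    exact Finset.sum_congr rfl fun α _ => L2_inner_eq_integral _ _
  rw [e1, e2, ← integral_const_mul]
  refine integral_mono_ae (i1.const_mul _) i2 ?_
  filter_upwards [htr, hstress, hsg, ha.symm, ha.elliptic] with x h1 h2 h3 h4 h5
  have hell := h5 (Matrix.of fun i α => symGrad v i α x)
    (by ext i j; simp [symGrad, add_comm]) (by simpa [Matrix.trace] using h1)
  simp only [Matrix.of_apply] at hell
  simp only [h2, h3]
  refine hell.trans (le_of_eq ?_)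
  -- by the symmetry `a_{ij}^{αβ} = a_{αj}^{iβ}` the stress is a symmetric matrix
  set S : Fin n → Fin n → ℝ := fun i α => ∑ j, ∑ β, a i j α β x * symGrad v j β x with hS
  have hsymm : ∀ i α, S i α = S α i := fun i α =>
    Finset.sum_congr rfl fun j _ => Finset.sum_congr rfl fun β _ => by rw [(h4 i j α β).1]
  have hl : ∑ i, ∑ j, ∑ α, ∑ β, a i j α β x * symGrad v i α x * symGrad v j β x =
      ∑ i, ∑ α, S i α * symGrad v i α x := by
    refine Finset.sum_congr rfl fun i _ => ?_
    rw [Finset.sum_comm]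
    refine Finset.sum_congr rfl fun α _ => ?_
    simp only [hS, Finset.sum_mul]
    exact Finset.sum_congr rfl fun j _ => Finset.sum_congr rfl fun β _ => by ring
  have hswap : ∑ i, ∑ α, S i α * pd (v α) i x = ∑ i, ∑ α, S i α * pd (v i) α x := by
    rw [Finset.sum_comm]
    exact Finset.sum_congr rfl fun i _ => Finset.sum_congr rfl fun α _ => by rw [hsymm]
  have hr : ∑ i, ∑ α, S i α * symGrad v i α x = 1 / 2 * (∑ i, ∑ α, S i α * pd (v α) i x) +
      1 / 2 * ∑ i, ∑ α, S i α * pd (v i) α x := by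
    simp only [Finset.mul_sum, ← Finset.sum_add_distrib]
    refine Finset.sum_congr rfl fun i _ => Finset.sum_congr rfl fun α _ => ?_
    rw [symGrad]; ring
  rw [hl, hr, hswap]
  ring

/-- The viscous form is coercive on divergence-free fields. -/
theorem viscousForm_coercive (hn : 3 ≤ n) {a : Tensor n} {c : ℝ} (hc : 0 < c)
    (ha : IsViscosityTensor a c) (v : H1Vec n) (hv : divL n v = 0) :
    c⁻¹ / 10 * ‖v‖ ^ 2 ≤ viscousForm ha.memLp v v := by
  have h1 := H1Vec_norm_sq_le hn v
  rw [korn v hv] at h1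
  have h2 := norm_symGradL_le_viscousForm ha v hv
  have h3 := mul_le_mul_of_nonneg_left h1 (inv_pos.2 hc).le
  linarith

theorem stokesOp_apply {a : Tensor n} (ha : ∀ i j α β, MemLp (a i j α β) ⊤ volume)
    (u : H1Vec n) (π : L2 n) (i : Fin n) (φ : Test n) :
    stokesOp a u π i φ = -∑ α, ⟪stressL ha i α u, pd (testToH1 φ) α⟫ +
      ⟪π, pd (testToH1 φ) i⟫ := by
  have h1 : ∀ α, distOf (fun x => ∑ j, ∑ β, a i j α β x * symGrad u j β x) =
      distOf (stressL ha i α u) := fun α =>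
    (distOf_congr (locallyIntegrable_L2 _) (coe_stressL ha i α u)).symm
  have h2 : ∀ (f : L2 n) (α : Fin n), (∂_{e α} (distOf f)) φ = -⟪f, pd (testToH1 φ) α⟫ := by
    intro f α
    rw [Distribution.lineDerivOp_apply_apply, map_neg, distOf_apply (locallyIntegrable_L2 _),
      real_inner_comm, inner_pd_testToH1]
  rw [stokesOp]
  simp only [h1]
  rw [sub_apply, sum_apply, h2]
  simp only [h2, Finset.sum_neg_distrib]
  ring

theorem divDistr_eq_iff (u : H1Vec n) (g : L2 n) : divDistr u = distOf g ↔ divL n u = g := by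
  have h1 : divDistr u = distOf (divL n u) := by
    ext φ
    have h2 : ∀ i, (∂_{e i} (distOf (fn (u i)))) φ = ⟪(memLp_test φ).toLp φ, pd (u i) i⟫ := by
      intro i
      rw [Distribution.lineDerivOp_apply_apply, map_neg, distOf_apply (locallyIntegrable_fn _),
        integral_lineDeriv_mul_fn, neg_neg, integral_test_mul_L2]
    rw [divDistr, sum_apply, distOf_apply (locallyIntegrable_L2 _), integral_test_mul_L2,
      divL_apply, inner_sum]
    exact Finset.sum_congr rfl fun i _ => h2 i
  rw [h1]
  refine ⟨fun h => ?_, fun h => by rw [h]⟩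
  refine Lp.ext (ae_eq_of_integral_test (locallyIntegrable_L2 _) (locallyIntegrable_L2 _)
    fun φ => ?_)
  rw [← distOf_apply (locallyIntegrable_L2 _), ← distOf_apply (locallyIntegrable_L2 _), h]

/-- The functional `v ↦ -∑ f_i(v_i)` on `ℋ¹(ℝⁿ)ⁿ`. -/
def loadL (f : Hm1Vec n) : H1Vec n →L[ℝ] ℝ :=
  -∑ i, (f i).comp (PiLp.proj 2 (fun _ : Fin n => H1 n) i)

theorem loadL_apply (f : Hm1Vec n) (v : H1Vec n) : loadL f v = -∑ i, f i (v i) := by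
  simp [loadL]

theorem norm_loadL_le (f : Hm1Vec n) : ‖loadL f‖ ≤ n * ‖f‖ := by
  refine ContinuousLinearMap.opNorm_le_bound _ (by positivity) fun v => ?_
  rw [loadL_apply, norm_neg]
  have h : ∀ i, ‖f i (v i)‖ ≤ ‖f‖ * ‖v‖ := fun i =>
    ((f i).le_opNorm _).trans (mul_le_mul (PiLp.norm_apply_le f i) (PiLp.norm_apply_le v i)
      (norm_nonneg _) (norm_nonneg f))
  refine (norm_sum_le_of_le _ fun i _ => h i).trans (le_of_eq ?_)
  simp
  ring

/-- The element of `ℋ¹(ℝⁿ)ⁿ` with `i`-th component `w` and all others zero. -/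
def singleH1 (i : Fin n) (w : H1 n) : H1Vec n := WithLp.toLp 2 (Pi.single i w)

theorem sum_singleH1 {F : Fin n → H1 n → ℝ} (hF : ∀ i, F i 0 = 0) (i : Fin n) (w : H1 n) :
    ∑ k, F k (singleH1 i w k) = F i w := by
  rw [Finset.sum_eq_single i (fun k _ hk => ?_) (by simp)]
  · simp [singleH1]
  · simp [singleH1, hk, hF]

/-- By density of the test functions, the Stokes system is a saddle-point problem on
`ℋ¹(ℝⁿ)ⁿ × L₂(ℝⁿ)`, with the pressure `-π` as the multiplier. -/
theorem isStokesSolution_iff {a : Tensor n} (ha : ∀ i j α β, MemLp (a i j α β) ⊤ volume)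
    (u : H1Vec n) (π : L2 n) (f : Hm1Vec n) (g : L2 n) :
    IsStokesSolution a u π f g ↔
      (∀ v, viscousForm ha u v + ⟪-π, divL n v⟫ = loadL f v) ∧ divL n u = g := by
  rw [IsStokesSolution, divDistr_eq_iff]
  refine and_congr_left fun _ => ?_
  simp only [stokesOp_apply ha]
  let F : Fin n → H1 n → ℝ := fun i w =>
    -∑ α, ⟪stressL ha i α u, pd w α⟫ + ⟪π, pd w i⟫ - f i w
  have hF0 : ∀ i, F i 0 = 0 := by
    intro i
    have : ∀ α : Fin n, pd (0 : H1 n) α = 0 := fun α => map_zero (pdL α)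
    simp [F, this]
  have hFc : ∀ i, Continuous (F i) := fun i =>
    ((continuous_finsetSum _ fun α _ => continuous_const.inner (continuous_pd α)).neg.add
      (continuous_const.inner (continuous_pd i))).sub (f i).continuous
  have hsum : ∀ v : H1Vec n, ∑ i, F i (v i) =
      -(viscousForm ha u v + ⟪-π, divL n v⟫ - loadL f v) := by
    intro v
    simp only [F, Finset.sum_sub_distrib, Finset.sum_add_distrib, Finset.sum_neg_distrib]
    rw [viscousForm_apply, divL_apply, loadL_apply, inner_neg_left, inner_sum]
    ring
  constructor
  · intro h v
    have hz : ∀ i w, F i w = 0 := fun i w =>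
      (denseRange_testToH1 n).induction_on (p := fun w : H1 n => F i w = 0) w
        (isClosed_eq (hFc i) continuous_const) fun φ => sub_eq_zero.2 (h i φ)
    have := hsum v
    simp only [hz, Finset.sum_const_zero] at this
    linarith
  · intro h i φ
    have h1 := hsum (singleH1 i (testToH1 φ))
    rw [h, sub_self, neg_zero, sum_singleH1 hF0] at h1
    exact sub_eq_zero.1 h1

/-! ### Well-posedness of the Stokes system -/

local instance instInnerProductSpaceH1Vec : InnerProductSpace ℝ (H1Vec n) :=
  PiLp.innerProductSpace _

local instance instNormedSpaceH1Vec : NormedSpace ℝ (H1Vec n) := PiLp.normedSpace 2 ℝ _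

local instance instNormedSpaceHm1Vec : NormedSpace ℝ (Hm1Vec n) := PiLp.normedSpace 2 ℝ _

theorem saddleConst_pos {κ α M : ℝ} (hκ : 0 < κ) (hα : 0 < α) (hM : 0 ≤ M) :
    0 < saddleConst κ α M := by
  unfold saddleConst
  positivity

/-- The inf-sup condition for the divergence, tested with gradients of test functions. -/
theorem norm_le_norm_adjoint_divL (hn : 3 ≤ n) (q : L2 n) :
    ‖q‖ ≤ √5 * ‖(ContinuousLinearMap.adjoint (E := H1Vec n) (F := L2 n) (divL n)) q‖ := by
  refine norm_le_norm_adjoint (V := H1Vec n) (Q := L2 n) (Real.sqrt_nonneg _)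
    (denseRange_laplacian hn) (fun φ => ?_) q
  refine abs_le_of_sq_le_sq' ?_ (by positivity) |>.2
  rw [mul_pow, Real.sq_sqrt (by norm_num)]
  exact norm_gradLin_sq_le hn φ

/-- The constant in the a priori estimate for the Stokes system. -/
def stokesConst (n : ℕ) (c M : ℝ) : ℝ :=
  saddleConst √5 (c⁻¹ / 10) (n ^ 4 * max M 0) * (n + 1)

theorem stokesConst_pos (n : ℕ) {c : ℝ} (hc : 0 < c) (M : ℝ) : 0 < stokesConst n c M :=
  mul_pos (saddleConst_pos (by positivity) (by positivity) (by positivity)) (by positivity)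

variable {a : Tensor n} {c M : ℝ}

/-- The a priori estimate for the Stokes system. -/
theorem IsStokesSolution.norm_le (hn : 3 ≤ n) (hc : 0 < c) (ha : IsViscosityTensor a c)
    (haM : tensorNorm a ≤ ENNReal.ofReal M) {u : H1Vec n} {π : L2 n} {f : Hm1Vec n} {g : L2 n}
    (h : IsStokesSolution a u π f g) : ‖u‖ + ‖π‖ ≤ stokesConst n c M * (‖f‖ + ‖g‖) := by
  have haM' : ∀ i j α β, eLpNorm (a i j α β) ⊤ volume ≤ ENNReal.ofReal (max M 0) := by
    intro i j α β
    refine le_trans ?_ (haM.trans (ENNReal.ofReal_le_ofReal (le_max_left M 0)))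
    exact le_iSup_of_le i (le_iSup_of_le j (le_iSup_of_le α (le_iSup_of_le β le_rfl)))
  obtain ⟨h1, h2⟩ := (isStokesSolution_iff ha.memLp u π f g).1 h
  have hest := saddle_estimate (V := H1Vec n) (Q := L2 n) (κ := √5) (α := c⁻¹ / 10)
    (M := n ^ 4 * max M 0) (by positivity) (by positivity) (by positivity)
    (norm_le_norm_adjoint_divL hn) (abs_viscousForm_le ha.memLp (le_max_right M 0) haM')
    (viscousForm_coercive hn hc ha) h1 h2
  rw [norm_neg] at hest
  refine hest.trans ?_
  have hS : 0 < saddleConst √5 (c⁻¹ / 10) (n ^ 4 * max M 0) :=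
    saddleConst_pos (by positivity) (by positivity) (by positivity)
  rw [stokesConst, mul_assoc]
  refine mul_le_mul_of_nonneg_left ?_ hS.le
  have hl := norm_loadL_le f
  have hf : 0 ≤ ‖f‖ := norm_nonneg f
  have hng : 0 ≤ (n : ℝ) * ‖g‖ := by positivity
  linarith

theorem exists_isStokesSolution (hn : 3 ≤ n) (hc : 0 < c) (ha : IsViscosityTensor a c)
    (f : Hm1Vec n) (g : L2 n) : ∃ (u : H1Vec n) (π : L2 n), IsStokesSolution a u π f g := by
  obtain ⟨u, p, h1, h2⟩ := saddle_exists (V := H1Vec n) (Q := L2 n) (κ := √5) (α := c⁻¹ / 10)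
    (by positivity) (by positivity) (norm_le_norm_adjoint_divL hn)
    (viscousForm_coercive hn hc ha) (loadL f) g
  exact ⟨u, -p, (isStokesSolution_iff ha.memLp _ _ _ _).2 ⟨by simpa using h1, h2⟩⟩

theorem IsStokesSolution.add (ha : IsViscosityTensor a c) {u v : H1Vec n} {π q : L2 n}
    {f k : Hm1Vec n} {g h : L2 n} (h1 : IsStokesSolution a u π f g)
    (h2 : IsStokesSolution a v q k h) : IsStokesSolution a (u + v) (π + q) (f + k) (g + h) := by
  rw [isStokesSolution_iff ha.memLp] at *
  refine ⟨fun w => ?_, by rw [map_add, h1.2, h2.2]⟩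
  have e1 := h1.1 w
  have e2 := h2.1 w
  have e3 : loadL (f + k) w = loadL f w + loadL k w := by
    simp only [loadL_apply]
    rw [← neg_add, ← Finset.sum_add_distrib]
    rfl
  rw [map_add, add_apply, e3, ← e1, ← e2, neg_add, inner_add_left]
  ring

theorem IsStokesSolution.smul (ha : IsViscosityTensor a c) {u : H1Vec n} {π : L2 n}
    {f : Hm1Vec n} {g : L2 n} (t : ℝ) (h1 : IsStokesSolution a u π f g) :
    IsStokesSolution a (t • u) (t • π) (t • f) (t • g) := by
  rw [isStokesSolution_iff ha.memLp] at *
  refine ⟨fun w => ?_, by rw [map_smul, h1.2]⟩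
  have e3 : loadL (t • f) w = t * loadL f w := by
    simp only [loadL_apply]
    rw [mul_neg, Finset.mul_sum]
    rfl
  rw [map_smul, smul_apply, e3, ← h1.1 w, ← smul_neg, real_inner_smul_left, smul_eq_mul]
  ring

theorem IsStokesSolution.unique (hn : 3 ≤ n) (hc : 0 < c) (ha : IsViscosityTensor a c)
    (haM : tensorNorm a ≤ ENNReal.ofReal M) {u v : H1Vec n} {π q : L2 n} {f : Hm1Vec n}
    {g : L2 n} (h1 : IsStokesSolution a u π f g) (h2 : IsStokesSolution a v q f g) :
    v = u ∧ q = π := by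
  have h := (h2.add ha (h1.smul ha (-1))).norm_le hn hc ha haM
  rw [neg_one_smul ℝ f, neg_one_smul ℝ g, neg_one_smul ℝ u, neg_one_smul ℝ π, add_neg_cancel f,
    add_neg_cancel g, norm_zero, show ‖(0 : Hm1Vec n)‖ = 0 from norm_zero (E := Hm1Vec n), add_zero,
    mul_zero] at h
  have e1 := norm_nonneg (v + -u)
  have e2 := norm_nonneg (q + -π)
  refine ⟨?_, ?_⟩
  · exact add_neg_eq_zero.1 (norm_eq_zero.1 (by linarith))
  · exact add_neg_eq_zero.1 (norm_eq_zero.1 (by linarith))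

/-- The Newtonian velocity and pressure potentials. -/
theorem existsUnique_newtonianPotentials (hn : 3 ≤ n) (hc : 0 < c) (ha : IsViscosityTensor a c)
    (haM : tensorNorm a ≤ ENNReal.ofReal M) :
    ∃! NQ : (Hm1Vec n →L[ℝ] H1Vec n) × (Hm1Vec n →L[ℝ] L2 n),
      ∀ f : Hm1Vec n, IsStokesSolution a (NQ.1 f) (NQ.2 f) f 0 := by
  choose N Q hNQ using fun f : Hm1Vec n => exists_isStokesSolution hn hc ha f 0
  have hadd : ∀ f k, N (f + k) = N f + N k ∧ Q (f + k) = Q f + Q k := fun f k =>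
    IsStokesSolution.unique hn hc ha haM (by simpa using (hNQ f).add ha (hNQ k)) (hNQ (f + k))
  have hsmul : ∀ (t : ℝ) f, N (t • f) = t • N f ∧ Q (t • f) = t • Q f := fun t f =>
    IsStokesSolution.unique hn hc ha haM (by simpa using (hNQ f).smul ha t) (hNQ (t • f))
  have hbd : ∀ f, ‖N f‖ + ‖Q f‖ ≤ stokesConst n c M * ‖f‖ := fun f => by
    simpa using (hNQ f).norm_le hn hc ha haM
  let NL : Hm1Vec n →L[ℝ] H1Vec n :=
    LinearMap.mkContinuous ⟨⟨N, fun f k => (hadd f k).1⟩, fun t f => (hsmul t f).1⟩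
      (stokesConst n c M) fun f => (le_add_of_nonneg_right (norm_nonneg _)).trans (hbd f)
  let QL : Hm1Vec n →L[ℝ] L2 n :=
    LinearMap.mkContinuous ⟨⟨Q, fun f k => (hadd f k).2⟩, fun t f => (hsmul t f).2⟩
      (stokesConst n c M) fun f => (le_add_of_nonneg_left (norm_nonneg _)).trans (hbd f)
  refine ⟨(NL, QL), hNQ, fun P hP => ?_⟩
  have h := fun f => IsStokesSolution.unique hn hc ha haM (hNQ f) (hP f)
  exact Prod.ext (ContinuousLinearMap.ext fun f => (h f).1)
    (ContinuousLinearMap.ext fun f => (h f).2)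

end StokesWeighted

end

open StokesWeighted
theorem mainTheorem7 (n : ℕ) (hn : 3 ≤ n) (c M : ℝ) (hc : 0 < c) :
    ∃ C : ℝ, 0 < C ∧
      ∀ a : Tensor n, IsViscosityTensor a c → tensorNorm a ≤ ENNReal.ofReal M →
        (∀ (f : Hm1Vec n) (g : L2 n),
          ∃ u : H1Vec n, ∃ π : L2 n,
            IsStokesSolution a u π f g ∧
            (∀ (v : H1Vec n) (q : L2 n), IsStokesSolution a v q f g → v = u ∧ q = π) ∧
            ‖u‖ + ‖π‖ ≤ C * (‖f‖ + ‖g‖)) ∧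
        ∃! NQ : (Hm1Vec n →L[ℝ] H1Vec n) × (Hm1Vec n →L[ℝ] L2 n),
          ∀ f : Hm1Vec n, IsStokesSolution a (NQ.1 f) (NQ.2 f) f 0 := by
  refine ⟨stokesConst n c M, stokesConst_pos n hc M, fun a ha haM => ⟨fun f g => ?_,
    existsUnique_newtonianPotentials hn hc ha haM⟩⟩
  obtain ⟨u, π, h⟩ := exists_isStokesSolution hn hc ha f g
  exact ⟨u, π, h, fun v q hvq => h.unique hn hc ha haM hvq, h.norm_le hn hc ha haM⟩
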